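/- Fix $\ell\ge 2$. For a finite set $M$ of $m=|M|\ge 1$ candidates, a top-$\ell$ ranking is a linear order on an $\ell$-element subset of $M$, and a profile is a finite sequence of top-$\ell$ rankings (votes). A (resolute) voting rule $r_\ell$ maps, for every such $M$, each profile over $M$ to a candidate in $M$, the winner; it is anonymous if permuting the votes of a profile never changes the winner. In the problem WAV-$r_\ell$ (winner with absent votes), the input consists of $M$, a profile $P$ of known votes, a number $t\ge 0$ of absent votes, and a candidate $c\in M$; the question is whether there is a profile $P'$ of exactly $t$ top-$\ell$ rankings such that $r_\ell(P\cup P')=c$, where $P\cup P'$ is the profile of all votes in $P$ and $P'$. Candidates and votes are listed explicitly in the input, and $t$ is given in unary. Let $r_\ell$ be an anonymous voting rule such that the winner $r_\ell(P)$ can be computed in time polynomial in the size of the input $(M,P)$. Then: 1. for every fixed $m\ge 2$, WAV-$r_\ell$ restricted to $m$ candidates (where $m$ is a constant and not part of the input) can be solved in polynomial time; 2. for every fixed $t\ge 0$, WAV-$r_\ell$ with $t$ absent votes (where $t$ is a constant and not part of the input) can be solved in polynomial time. -/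

import Mathlib

open Computability

/-- A top-`ℓ` ranking of the candidate set `{0, …, m - 1}`: a linear order on an `ℓ`-subset,
given by the candidate `v i` in each position `i` (position `0` is the most preferred one). -/
abbrev TopRanking (ℓ m : ℕ) : Type := Fin ℓ ↪ Fin m

/-- A profile is the vector of the votes of all voters. -/
abbrev Profile (ℓ m : ℕ) : Type := List (TopRanking ℓ m)

/-- A resolute voting rule for top-`ℓ` rankings: for every nonempty finite set of candidates,
a map from profiles (with any number of votes) to candidates. -/
abbrev VotingRule (ℓ : ℕ) : Type := (m : ℕ+) → Profile ℓ m → Fin m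

namespace VotingRule

variable {ℓ : ℕ}

/-- A rule is anonymous if permuting the voters never changes the winner. -/
def Anonymous (r : VotingRule ℓ) : Prop :=
  ∀ (m : ℕ+) (P Q : Profile ℓ m), P.Perm Q → r m P = r m Q

/-- The question of "winner with absent votes": can `t` further votes be cast such that
`c` wins under `r`, given the profile `P` of known votes? -/
def WAV (r : VotingRule ℓ) (m : ℕ+) (P : Profile ℓ m) (t : ℕ) (c : Fin m) : Prop :=
  ∃ P' : Profile ℓ m, P'.length = t ∧ r m (P ++ P') = c

end VotingRule

/-- A natural number in unary, followed by an end marker. -/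
def encodeField (n : ℕ) : List Bool := unaryEncodeNat n ++ [false]

/-- A vote is written as the list of its `ℓ` candidates, in order of preference. -/
def encodeVote {ℓ m : ℕ} (v : TopRanking ℓ m) : List Bool :=
  (List.ofFn v).flatMap fun c : Fin m => encodeField c

/-- A profile is written vote by vote. -/
def encodeProfile {ℓ m : ℕ} (P : Profile ℓ m) : List Bool := P.flatMap encodeVote

/-- An election consists of a set of candidates and a profile. -/
abbrev Election (ℓ : ℕ) : Type := (m : ℕ+) × Profile ℓ m

/-- The candidate set takes `m + 1` symbols; as listing its elements takes at least `m` symbols,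
this is polynomially equivalent to any reasonable explicit encoding of the candidates. -/
def encodeElection {ℓ : ℕ} (E : Election ℓ) : List Bool :=
  encodeField E.1 ++ encodeProfile E.2

/-- An instance with a fixed number `m` of candidates: the known votes, the number of absent votes
and the target candidate. -/
structure FixedCandidatesInstance (ℓ : ℕ) (m : ℕ+) where
  known : Profile ℓ m
  absent : ℕ
  target : Fin m

/-- The number of absent votes is written in unary. -/
def FixedCandidatesInstance.encode {ℓ : ℕ} {m : ℕ+} (I : FixedCandidatesInstance ℓ m) :
    List Bool :=
  encodeField I.absent ++ encodeField I.target ++ encodeProfile I.known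

/-- An instance with a fixed number of absent votes: the candidates, the known votes and the
target candidate. -/
structure FixedAbsentInstance (ℓ : ℕ) where
  candidates : ℕ+
  known : Profile ℓ candidates
  target : Fin candidates

def FixedAbsentInstance.encode {ℓ : ℕ} (I : FixedAbsentInstance ℓ) : List Bool :=
  encodeField I.candidates ++ encodeField I.target ++ encodeProfile I.known

open scoped Classical in
/-- A decision problem, with instances written as words, is solved by a Turing machine whose
running time is bounded by a polynomial in the length of the input. -/
def PolyTimeSolvable {α : Type} (enc : α → List Bool) (p : α → Prop) : Prop :=
  Nonempty (Turing.TM2ComputableInPolyTime enc encodeBool fun a => decide (p a))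

namespace VotingRule

variable {ℓ : ℕ}

/-- The (index of the) winner of an election is computed by a polynomial-time Turing machine to
which both the candidate set and the profile are given as input. -/
def PolyTimeComputable (r : VotingRule ℓ) : Prop :=
  Nonempty (Turing.TM2ComputableInPolyTime (encodeElection (ℓ := ℓ)) unaryEncodeNat
    fun E => (r E.1 E.2 : ℕ))

end VotingRule

/-! The proof is an exhaustive search over the absent votes, with the winner machine as a
subroutine.

For fixed `m`, anonymity means that only the multiset of absent votes matters. It is a vector of
multiplicities with sum `t`, indexed by the top-`ℓ` rankings (`wav_iff_exists_counts`). Their number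
N is a constant, so there are at most (t + 1)^N vectors, which is polynomial because `t` is unary.
Listing all profiles of length `t` would be exponential.

For fixed `t`, the absent votes have tℓ entries, each a candidate, so there are at most m^(tℓ)
profiles to try (`wav_iff_exists_isProfile`).

Both cases ask for a vector of counters, indexed by a fixed finite type and bounded by a number in
the input, with a property that one call of the winner machine decides. `polyTimeSolvable_search`
answers this by nested loops (`polyRuns_search`). One round tests the counters, writes the election,
calls the machine and compares its output with the target (`polyRuns_attempt`).

Since solvability refers to actual stack machines, the loops are programmed explicitly: code
fragments with additive running times, registers holding words and unary numbers, and `PolyRuns`,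
which asks for one polynomial bounding the time for all indices. -/

namespace StackProgram

open Turing Turing.TM2 Function

/-! ### Runs of stack machines and composition of code fragments -/

section Fragments

variable {K : Type} [DecidableEq K] {Γ : K → Type} {σ Λ Λ' : Type}

/-- A run of exactly `n` steps of a stack machine. -/
inductive StepsIn (M : Λ → Stmt Γ Λ σ) : ℕ → Cfg Γ Λ σ → Cfg Γ Λ σ → Prop
  | refl (c) : StepsIn M 0 c c
  | head {n c c' c''} : step M c = some c' → StepsIn M n c' c'' → StepsIn M (n + 1) c c''

theorem StepsIn.trans {M : Λ → Stmt Γ Λ σ} {n n' : ℕ} {c c' c'' : Cfg Γ Λ σ}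
    (h : StepsIn M n c c') (h' : StepsIn M n' c' c'') : StepsIn M (n + n') c c'' := by
  induction h with
  | refl => simpa using h'
  | head hs _ ih =>
    rw [Nat.add_right_comm]
    exact .head hs (ih h')

theorem StepsIn.iterate_eq {M : Λ → Stmt Γ Λ σ} {n : ℕ} {c c' : Cfg Γ Λ σ}
    (h : StepsIn M n c c') : (flip bind (step M))^[n] (some c) = some c' := by
  induction h with
  | refl => rfl
  | head hs _ ih =>
    rw [iterate_succ_apply]
    simpa [flip, hs] using ih

theorem StepsIn.of_iterate {M : Λ → Stmt Γ Λ σ} {n : ℕ} {c c' : Cfg Γ Λ σ}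
    (h : (flip bind (step M))^[n] (some c) = some c') : StepsIn M n c c' := by
  induction n generalizing c with
  | zero => cases h; exact .refl _
  | succ n ih =>
    rw [iterate_succ_apply] at h
    cases hs : step M c with
    | none =>
      -- `none` is absorbing, so an iterate that ends in `some c'` has made a genuine step each
      -- time.
      have key : ∀ n, (flip bind (step M))^[n] (none : Option (Cfg Γ Λ σ)) = none := by
        intro n
        induction n with
        | zero => rfl
        | succ n ih => rw [iterate_succ_apply]; exact ih
      have h' : (flip bind (step M))^[n] (none : Option (Cfg Γ Λ σ)) = some c' := by
        simpa [flip, hs] using h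
      rw [key n] at h'
      cases h'
    | some c₁ => exact .head hs (ih (by simpa [flip, hs] using h))

theorem StepsIn.map {K' : Type} [DecidableEq K'] {Γ' : K' → Type} {σ' : Type}
    {M : Λ → Stmt Γ Λ σ} {M' : Λ' → Stmt Γ' Λ' σ'} (φ : Cfg Γ Λ σ → Cfg Γ' Λ' σ')
    (hφ : ∀ c c', step M c = some c' → step M' (φ c) = some (φ c'))
    {n : ℕ} {c c' : Cfg Γ Λ σ} (h : StepsIn M n c c') : StepsIn M' n (φ c) (φ c') := by
  induction h with
  | refl => exact .refl _
  | head hs _ ih => exact .head (hφ _ _ hs) ih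

/-- Rename the labels of a statement by `g` and replace halting by a jump to `e`
(if `e` is a label). -/
def relabel (g : Λ → Λ') (e : Option Λ') : Stmt Γ Λ σ → Stmt Γ Λ' σ
  | .push k f q => .push k f (relabel g e q)
  | .peek k f q => .peek k f (relabel g e q)
  | .pop k f q => .pop k f (relabel g e q)
  | .load f q => .load f (relabel g e q)
  | .branch f q q' => .branch f (relabel g e q) (relabel g e q')
  | .goto f => .goto fun v => g (f v)
  | .halt => e.elim .halt fun l => .goto fun _ => l

/-- If `e` is a label, the final configuration of one fragment becomes literally the initial
configuration of the next, so gluing costs no extra step. -/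
def relabelCfg (g : Λ → Λ') (e : Option Λ') (c : Cfg Γ Λ σ) : Cfg Γ Λ' σ :=
  ⟨c.l.elim e fun l => some (g l), c.var, c.stk⟩

theorem stepAux_relabel (g : Λ → Λ') (e : Option Λ') (q : Stmt Γ Λ σ) (v : σ)
    (S : ∀ k, List (Γ k)) :
    stepAux (relabel g e q) v S = relabelCfg g e (stepAux q v S) := by
  induction q generalizing v S with
  | branch f q q' ih ih' => cases h : f v <;> simp [relabel, h, ih, ih']
  | goto f => rfl
  | halt => cases e <;> rfl
  | _ => simp only [relabel, stepAux, *]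

theorem StepsIn.relabel {M : Λ → Stmt Γ Λ σ} {M' : Λ' → Stmt Γ Λ' σ} (g : Λ → Λ')
    (e : Option Λ') (hM : ∀ l, M' (g l) = StackProgram.relabel g e (M l)) {n : ℕ}
    {c c' : Cfg Γ Λ σ} (h : StepsIn M n c c') :
    StepsIn M' n (relabelCfg g e c) (relabelCfg g e c') := by
  refine h.map _ ?_
  rintro ⟨_ | l, v, S⟩ c' hc
  · cases hc
  · obtain rfl : stepAux (M l) v S = c' := by simpa using hc
    change some (stepAux (M' (g l)) v S) = _
    rw [hM, stepAux_relabel]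

end Fragments

/-- A piece of code for a stack machine; it is entered at `main` and left by halting. -/
structure Fragment {K : Type} (Γ : K → Type) (σ : Type) where
  Λ : Type
  [fin : Fintype Λ]
  main : Λ
  code : Λ → Stmt Γ Λ σ

attribute [instance] Fragment.fin

namespace Fragment

variable {K : Type} [DecidableEq K] {Γ : K → Type} {σ : Type}

/-- Starting in state `v` with stacks `S`, the fragment halts within `n` steps in state `v'` with
stacks `S'`. -/
def Executes (A : Fragment Γ σ) (v : σ) (S : ∀ k, List (Γ k)) (v' : σ) (S' : ∀ k, List (Γ k))
    (n : ℕ) : Prop :=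
  ∃ j ≤ n, StepsIn A.code j ⟨some A.main, v, S⟩ ⟨none, v', S'⟩

/-- A fragment that consists of a single statement, which does not jump. -/
def single (q : Stmt Γ Unit σ) : Fragment Γ σ where
  Λ := Unit
  main := ()
  code _ := q

theorem executes_single {q : Stmt Γ Unit σ} {v v' : σ} {S S' : ∀ k, List (Γ k)}
    (h : stepAux q v S = ⟨none, v', S'⟩) : (single q).Executes v S v' S' 1 :=
  ⟨1, le_rfl, .head (congrArg some h) (.refl _)⟩

/-- Sequential composition. -/
def seq (A B : Fragment Γ σ) : Fragment Γ σ where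
  Λ := A.Λ ⊕ B.Λ
  main := .inl A.main
  code := Sum.elim (fun l => relabel .inl (some (.inr B.main)) (A.code l))
    fun l => relabel .inr none (B.code l)

theorem Executes.seq {A B : Fragment Γ σ} {v v' v'' : σ} {S S' S'' : ∀ k, List (Γ k)} {n n' : ℕ}
    (hA : A.Executes v S v' S' n) (hB : B.Executes v' S' v'' S'' n') :
    (A.seq B).Executes v S v'' S'' (n + n') := by
  obtain ⟨i, hi, hA⟩ := hA
  obtain ⟨j, hj, hB⟩ := hB
  refine ⟨i + j, Nat.add_le_add hi hj, ?_⟩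
  exact (hA.relabel (M' := (A.seq B).code) .inl (some (.inr B.main)) fun _ => rfl).trans
    (hB.relabel (M' := (A.seq B).code) .inr none fun _ => rfl)

/-- Execute the statement `q`, which ends with a jump to the body with a given index or with
halting; after a body, continue with `q` again if `again` is set, and halt otherwise. -/
def control {ι : Type} [Fintype ι] (q : Stmt Γ ι σ) (A : ι → Fragment Γ σ) (again : Bool) :
    Fragment Γ σ where
  Λ := Option (Σ i, (A i).Λ)
  main := none
  code := fun l => l.elim (relabel (fun i => some ⟨i, (A i).main⟩) none q)
    fun l => relabel (fun l' => some ⟨l.1, l'⟩) (if again then some none else none)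
      ((A l.1).code l.2)

variable {ι : Type} [Fintype ι] {q : Stmt Γ ι σ} {A : ι → Fragment Γ σ}

theorem executes_control_halt {again : Bool} {v v' : σ} {S S' : ∀ k, List (Γ k)}
    (h : stepAux q v S = ⟨none, v', S'⟩) : (control q A again).Executes v S v' S' 1 := by
  refine ⟨1, le_rfl, .head (congrArg some ?_) (.refl _)⟩
  refine (stepAux_relabel _ _ q v S).trans ?_
  rw [h]
  rfl

theorem executes_control_once {i : ι} {v v' v'' : σ} {S S' S'' : ∀ k, List (Γ k)} {n : ℕ}
    (h : stepAux q v S = ⟨some i, v', S'⟩) (hA : (A i).Executes v' S' v'' S'' n) :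
    (control q A false).Executes v S v'' S'' (n + 1) := by
  obtain ⟨j, hj, hA⟩ := hA
  refine ⟨j + 1, by omega, .head (congrArg some ?_)
    (hA.relabel (M' := (control q A false).code) (fun l' => some ⟨i, l'⟩) none fun _ => rfl)⟩
  refine (stepAux_relabel _ _ q v S).trans ?_
  rw [h]
  rfl

theorem executes_control_again {i : ι} {v v' v'' v₃ : σ} {S S' S'' S₃ : ∀ k, List (Γ k)}
    {n n' : ℕ} (h : stepAux q v S = ⟨some i, v', S'⟩) (hA : (A i).Executes v' S' v'' S'' n)
    (hB : (control q A true).Executes v'' S'' v₃ S₃ n') :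
    (control q A true).Executes v S v₃ S₃ (n + n' + 1) := by
  obtain ⟨j, hj, hA⟩ := hA
  obtain ⟨j', hj', hB⟩ := hB
  refine ⟨j + j' + 1, by omega, .head (congrArg some ?_)
    ((hA.relabel (M' := (control q A true).code) (fun l' => some ⟨i, l'⟩) (some none)
      fun _ => rfl).trans hB)⟩
  refine (stepAux_relabel _ _ q v S).trans ?_
  rw [h]
  rfl

end Fragment

/-! ### Programs with a subroutine -/

section Programs

variable {K : Type} {M : FinTM2}

/-- Boolean registers indexed by `K`, next to the stacks of the machine `M`. -/
@[reducible] def stackAlphabet (K : Type) (M : FinTM2) : K ⊕ M.K → Type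
  | .inl _ => Bool
  | .inr k => M.Γ k

/-- A program with registers in `K` that may use `M` as a subroutine. Its own state is a
single optional bit, which holds the symbol read last. -/
abbrev Program (K : Type) (M : FinTM2) : Type 1 :=
  Fragment (stackAlphabet K M) (Option Bool × M.σ)

def joinStacks (T : K → List Bool) (U : ∀ k, List (M.Γ k)) :
    ∀ k, List (stackAlphabet K M k)
  | .inl k => T k
  | .inr k => U k

@[simp] theorem joinStacks_inl (T : K → List Bool) (U : ∀ k, List (M.Γ k)) (k : K) :
    joinStacks T U (.inl k) = T k := rfl

@[simp] theorem joinStacks_inr (T : K → List Bool) (U : ∀ k, List (M.Γ k)) (k : M.K) :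
    joinStacks T U (.inr k) = U k := rfl

variable [DecidableEq K]

@[simp] theorem update_joinStacks_inl (T : K → List Bool) (U : ∀ k, List (M.Γ k)) (k : K)
    (l : List Bool) :
    update (joinStacks T U) (.inl k) l = joinStacks (update T k l) U := by
  funext k'
  rcases k' with k' | k'
  · by_cases h : k' = k
    · subst h; simp
    · simp [h]
  · simp

@[simp] theorem update_joinStacks_inr (T : K → List Bool) (U : ∀ k, List (M.Γ k)) (k : M.K)
    (l : List (M.Γ k)) :
    update (joinStacks T U) (.inr k) l = joinStacks T (update U k l) := by
  funext k'
  rcases k' with k' | k'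
  · simp
  · by_cases h : k' = k
    · subst h; simp
    · simp [h]

def emptyStacks (M : FinTM2) : ∀ k, List (M.Γ k) := fun _ => []

/-- The program transforms the registers from `T` to `T'` within `n` steps, and leaves the
subroutine `M` in its initial state, with empty stacks. -/
def Runs (A : Program K M) (T T' : K → List Bool) (n : ℕ) : Prop :=
  ∀ b, ∃ b', A.Executes (b, M.initialState) (joinStacks T (emptyStacks M))
    (b', M.initialState) (joinStacks T' (emptyStacks M)) n

theorem Runs.mono {A : Program K M} {T T' : K → List Bool} {n n' : ℕ} (h : Runs A T T' n)
    (hn : n ≤ n') : Runs A T T' n' := fun b =>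
  let ⟨b', j, hj, hs⟩ := h b
  ⟨b', j, hj.trans hn, hs⟩

theorem Runs.seq {A B : Program K M} {T T' T'' : K → List Bool} {n n' : ℕ} (hA : Runs A T T' n)
    (hB : Runs B T' T'' n') : Runs (A.seq B) T T'' (n + n') := fun b =>
  let ⟨b', h⟩ := hA b
  let ⟨b'', h'⟩ := hB b'
  ⟨b'', h.seq h'⟩

def skip : Program K M := Fragment.single .halt

theorem runs_skip (T : K → List Bool) : Runs (M := M) skip T T 1 := fun b =>
  ⟨b, Fragment.executes_single rfl⟩

def push (k : K) (x : Bool) : Program K M := Fragment.single (.push (.inl k) (fun _ => x) .halt)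

theorem runs_push (k : K) (x : Bool) (T : K → List Bool) :
    Runs (M := M) (push k x) T (update T k (x :: T k)) 1 := fun b =>
  ⟨b, Fragment.executes_single (by simp)⟩

/-- Pop the top symbol of the register `k` and continue with the program indexed by it. -/
def popCase (k : K) (A : Option Bool → Program K M) : Program K M :=
  Fragment.control (.pop (.inl k) (fun v o => (o, v.2)) (.goto fun v => v.1)) A false

theorem runs_popCase {k : K} {A : Option Bool → Program K M} {T T' : K → List Bool} {n : ℕ}
    (h : Runs (A (T k).head?) (update T k (T k).tail) T' n) :
    Runs (popCase k A) T T' (n + 1) := fun _ =>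
  let ⟨b', h'⟩ := h (T k).head?
  ⟨b', Fragment.executes_control_once (i := (T k).head?) (by simp) h'⟩

/-- Pop symbols off the register `k` and execute the programs indexed by them,
until a symbol satisfies `isEnd`. -/
def loop (k : K) (isEnd : Option Bool → Bool) (A : Option Bool → Program K M) : Program K M :=
  Fragment.control (.pop (.inl k) (fun v o => (o, v.2))
    (.branch (fun v => isEnd v.1) .halt (.goto fun v => v.1))) A true

theorem runs_loop_end {k : K} {isEnd : Option Bool → Bool} {A : Option Bool → Program K M}
    {T : K → List Bool} (h : isEnd (T k).head? = true) :
    Runs (loop k isEnd A) T (update T k (T k).tail) 1 := fun _ =>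
  ⟨(T k).head?, Fragment.executes_control_halt (by simp [h])⟩

theorem runs_loop_step {k : K} {isEnd : Option Bool → Bool} {A : Option Bool → Program K M}
    {T T' T'' : K → List Bool} {n n' : ℕ} (h : isEnd (T k).head? = false)
    (hA : Runs (A (T k).head?) (update T k (T k).tail) T' n)
    (hB : Runs (loop k isEnd A) T' T'' n') : Runs (loop k isEnd A) T T'' (n + n' + 1) := fun _ =>
  let ⟨b', h'⟩ := hA (T k).head?
  let ⟨b'', h''⟩ := hB b'
  ⟨b'', Fragment.executes_control_again (i := (T k).head?) (by simp [h]) h' h''⟩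

/-! ### Calling the subroutine -/

def liftStmt : Stmt M.Γ M.Λ M.σ → Stmt (stackAlphabet K M) M.Λ (Option Bool × M.σ)
  | .push k f q => .push (.inr k) (fun v => f v.2) (liftStmt q)
  | .peek k f q => .peek (.inr k) (fun v o => (v.1, f v.2 o)) (liftStmt q)
  | .pop k f q => .pop (.inr k) (fun v o => (v.1, f v.2 o)) (liftStmt q)
  | .load f q => .load (fun v => (v.1, f v.2)) (liftStmt q)
  | .branch f q q' => .branch (fun v => f v.2) (liftStmt q) (liftStmt q')
  | .goto f => .goto fun v => f v.2
  | .halt => .halt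

def liftCfg (b : Option Bool) (T : K → List Bool) (c : Cfg M.Γ M.Λ M.σ) :
    Cfg (stackAlphabet K M) M.Λ (Option Bool × M.σ) :=
  ⟨c.l, (b, c.var), joinStacks T c.stk⟩

theorem stepAux_liftStmt (b : Option Bool) (T : K → List Bool) (q : Stmt M.Γ M.Λ M.σ) (v : M.σ)
    (U : ∀ k, List (M.Γ k)) :
    stepAux (liftStmt q) (b, v) (joinStacks T U) = liftCfg b T (stepAux q v U) := by
  induction q generalizing v U with
  | branch f q q' ih ih' => cases h : f v <;> simp [liftStmt, h, ih, ih']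
  | goto f => rfl
  | halt => rfl
  | _ => simp [liftStmt, *]

/-- The subroutine as a program. -/
def machine : Program K M := by
  letI := M.ΛFin
  exact { Λ := M.Λ, main := M.main, code := fun l => liftStmt (M.m l) }

theorem StepsIn.lift {n : ℕ} {c c' : Cfg M.Γ M.Λ M.σ} (h : StepsIn M.m n c c') (b : Option Bool)
    (T : K → List Bool) :
    StepsIn (fun l => liftStmt (K := K) (M.m l)) n (liftCfg b T c) (liftCfg b T c') := by
  refine h.map _ ?_
  rintro ⟨_ | l, v, S⟩ c' hc
  · cases hc
  · obtain rfl : stepAux (M.m l) v S = c' := by simpa using hc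
    exact congrArg some (stepAux_liftStmt b T _ _ _)

theorem initList_eq (s : List (M.Γ M.k₀)) :
    initList M s = ⟨some M.main, M.initialState, update (emptyStacks M) M.k₀ s⟩ := by
  unfold initList
  congr 1
  funext k
  by_cases h : k = M.k₀
  · subst h; simp
  · simp [h, emptyStacks]

/-- A machine may only halt in its initial state with all stacks but the output empty. Once the
output is unloaded it is ready for another call, and the search relies on this. -/
theorem haltList_eq (s : List (M.Γ M.k₁)) :
    haltList M s = ⟨none, M.initialState, update (emptyStacks M) M.k₁ s⟩ := by
  unfold haltList
  congr 1
  funext k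
  by_cases h : k = M.k₁
  · subst h; simp
  · simp [h, emptyStacks]

theorem executes_machine {s : List (M.Γ M.k₀)} {s' : List (M.Γ M.k₁)} {n : ℕ}
    (h : TM2OutputsInTime M s (some s') n) (b : Option Bool) (T : K → List Bool) :
    machine.Executes (b, M.initialState) (joinStacks T (update (emptyStacks M) M.k₀ s))
      (b, M.initialState) (joinStacks T (update (emptyStacks M) M.k₁ s')) n := by
  obtain ⟨⟨j, hj⟩, hn⟩ := h
  refine ⟨j, hn, ?_⟩
  have h' : StepsIn M.m j (initList M s) (haltList M s') := .of_iterate hj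
  rw [initList_eq, haltList_eq] at h'
  exact h'.lift b T

def loadStmt (e : M.Γ M.k₀ ≃ Bool) (k : K) : Stmt (stackAlphabet K M) Unit (Option Bool × M.σ) :=
  .pop (.inl k) (fun v o => (o, v.2)) (.branch (fun v => v.1.isSome)
    (.push (.inr M.k₀) (fun v => e.symm (v.1.getD false)) (.goto fun _ => ())) .halt)

/-- Move the register `k` to the input stack of the subroutine. -/
def loadInput (e : M.Γ M.k₀ ≃ Bool) (k : K) : Program K M :=
  Fragment.control (loadStmt e k) (fun _ => skip) true

theorem executes_loadInput (e : M.Γ M.k₀ ≃ Bool) (k : K) (l : List Bool) :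
    ∀ (s : List (M.Γ M.k₀)) (b : Option Bool) (T : K → List Bool), T k = l → ∃ b',
    (loadInput e k).Executes (b, M.initialState) (joinStacks T (update (emptyStacks M) M.k₀ s))
      (b', M.initialState) (joinStacks (update T k [])
        (update (emptyStacks M) M.k₀ (l.reverse.map e.symm ++ s))) (2 * l.length + 1) := by
  induction l with
  | nil => exact fun s b T hT => ⟨none, Fragment.executes_control_halt (by simp [loadStmt, hT])⟩
  | cons x l ih =>
    intro s b T hT
    obtain ⟨b', h⟩ := ih (e.symm x :: s) (some x) (update T k l) (by simp)
    refine ⟨b', ?_⟩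
    have := Fragment.executes_control_again (v := (b, M.initialState))
      (S := joinStacks T (update (emptyStacks M) M.k₀ s)) (i := ())
      (q := loadStmt e k) (A := fun _ => skip)
      (by simp only [loadStmt, stepAux, joinStacks_inl, hT]; simp) (Fragment.executes_single rfl) h
    obtain ⟨j, hj, hs⟩ := this
    refine ⟨j, by simp; omega, ?_⟩
    simpa [loadInput] using hs

def unloadStmt (e : M.Γ M.k₁ ≃ Bool) (k : K) :
    Stmt (stackAlphabet K M) Unit (Option Bool × M.σ) :=
  .pop (.inr M.k₁) (fun v o => (o.map e, v.2)) (.branch (fun v => v.1.isSome)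
    (.push (.inl k) (fun v => v.1.getD false) (.goto fun _ => ())) .halt)

/-- Move the output stack of the subroutine to the register `k`. -/
def unloadOutput (e : M.Γ M.k₁ ≃ Bool) (k : K) : Program K M :=
  Fragment.control (unloadStmt e k) (fun _ => skip) true

theorem executes_unloadOutput (e : M.Γ M.k₁ ≃ Bool) (k : K) (l : List Bool) :
    ∀ (b : Option Bool) (T : K → List Bool), ∃ b',
    (unloadOutput e k).Executes (b, M.initialState)
      (joinStacks T (update (emptyStacks M) M.k₁ (l.map e.symm)))
      (b', M.initialState) (joinStacks (update T k (l.reverse ++ T k)) (emptyStacks M))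
      (2 * l.length + 1) := by
  induction l with
  | nil =>
    refine fun b T => ⟨none, Fragment.executes_control_halt ?_⟩
    have : update (emptyStacks M) M.k₁ [] = emptyStacks M := update_eq_self _ _
    rw [List.map_nil, this]
    have h₀ : emptyStacks M M.k₁ = [] := rfl
    simp [unloadStmt, h₀, this]
  | cons x l ih =>
    intro b T
    obtain ⟨b', h⟩ := ih (some x) (update T k (x :: T k))
    refine ⟨b', ?_⟩
    have := Fragment.executes_control_again (v := (b, M.initialState))
      (S := joinStacks T (update (emptyStacks M) M.k₁ ((x :: l).map e.symm))) (i := ())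
      (q := unloadStmt e k) (A := fun _ => skip)
      (by simp [unloadStmt]) (Fragment.executes_single rfl) h
    obtain ⟨j, hj, hs⟩ := this
    refine ⟨j, by simp; omega, ?_⟩
    simpa [unloadOutput] using hs

/-- Run the subroutine on the reversal of the register `k`; its output goes to `k'`. -/
def call (e₀ : M.Γ M.k₀ ≃ Bool) (e₁ : M.Γ M.k₁ ≃ Bool) (k k' : K) : Program K M :=
  ((loadInput e₀ k).seq machine).seq (unloadOutput e₁ k')

/-- Moving a stack reverses it, whence both reversals. The one of the output is harmless later, as
the output is unary. -/
theorem runs_call {e₀ : M.Γ M.k₀ ≃ Bool} {e₁ : M.Γ M.k₁ ≃ Bool} {k k' : K} {T : K → List Bool}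
    {w u : List Bool} {n : ℕ} (hT : T k = w.reverse) (hu : T k' = [])
    (hk : k' ≠ k)
    (h : TM2OutputsInTime M (w.map e₀.symm) (some (u.map e₁.symm)) n) :
    Runs (call e₀ e₁ k k') T (update (update T k []) k' u.reverse)
      (2 * w.length + 1 + n + (2 * u.length + 1)) := by
  intro b
  obtain ⟨b₁, h₁⟩ := executes_loadInput e₀ k w.reverse [] b T hT
  obtain ⟨b₂, h₂⟩ := executes_unloadOutput e₁ k' u b₁ (update T k [])
  refine ⟨b₂, ?_⟩
  have h₃ := executes_machine h b₁ (update T k [])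
  have h₄ : update (emptyStacks M) M.k₀ [] = emptyStacks M := update_eq_self _ _
  simp only [h₄, List.reverse_reverse, List.append_nil, List.length_reverse] at h₁
  simpa [call, hu, hk] using (h₁.seq h₃).seq h₂

/-! ### Programs as machines -/

/-- A halting configuration must carry the initial state, whereas a program may leave any symbol in
its own bit. -/
def reset : Program K M := Fragment.single (.load (fun v => (none, v.2)) .halt)

/-- A program, with designated registers for input and output, as a machine. -/
def toFinTM2 [Fintype K] (A : Program K M) (i o : K) : FinTM2 :=
  letI := M.kFin
  letI := M.σFin
  { K := K ⊕ M.K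
    k₀ := .inl i
    k₁ := .inl o
    Γ := stackAlphabet K M
    Λ := (A.seq reset).Λ
    main := (A.seq reset).main
    σ := Option Bool × M.σ
    initialState := (none, M.initialState)
    Γk₀Fin := inferInstanceAs (Fintype Bool)
    m := (A.seq reset).code }

theorem initList_toFinTM2 [Fintype K] (A : Program K M) (i o : K) (x : List Bool) :
    (initList (toFinTM2 A i o) x : Cfg (stackAlphabet K M) (A.seq reset).Λ _) =
      ⟨some (A.seq reset).main, (none, M.initialState),
        joinStacks (update (fun _ => []) i x) (emptyStacks M)⟩ := by
  refine (initList_eq (M := toFinTM2 A i o) x).trans ?_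
  congr 1
  refine Eq.trans ?_ (update_joinStacks_inl (M := M) (fun _ => []) (emptyStacks M) i x)
  congr 1
  funext k
  rcases k with k | k <;> rfl

theorem haltList_toFinTM2 [Fintype K] (A : Program K M) (i o : K) (x : List Bool) :
    (haltList (toFinTM2 A i o) x : Cfg (stackAlphabet K M) (A.seq reset).Λ _) =
      ⟨none, (none, M.initialState),
        joinStacks (update (fun _ => []) o x) (emptyStacks M)⟩ := by
  refine (haltList_eq (M := toFinTM2 A i o) x).trans ?_
  congr 1
  refine Eq.trans ?_ (update_joinStacks_inl (M := M) (fun _ => []) (emptyStacks M) o x)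
  congr 1
  funext k
  rcases k with k | k <;> rfl

theorem outputs_toFinTM2 [Fintype K] {A : Program K M} {i o : K} {x y : List Bool} {n : ℕ}
    (h : Runs A (update (fun _ => []) i x) (update (fun _ => []) o y) n) :
    Nonempty (TM2OutputsInTime (toFinTM2 A i o) x (some y) (n + 1)) := by
  obtain ⟨b', h⟩ := h none
  have h' : reset.Executes (b', M.initialState) (joinStacks (update (fun _ => []) o y)
    (emptyStacks M)) (none, M.initialState) (joinStacks (update (fun _ => []) o y)
    (emptyStacks M)) 1 := Fragment.executes_single rfl
  obtain ⟨j, hj, hs⟩ := h.seq h'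
  have hi := congrArg (fun c => (flip bind (step (A.seq reset).code))^[j] (some c))
    (initList_toFinTM2 A i o x)
  exact ⟨⟨⟨j, hi.trans (hs.iterate_eq.trans (congrArg some (haltList_toFinTM2 A i o y).symm))⟩,
    hj⟩⟩

/-- A decision problem is solvable in polynomial time if some program writes the answer into
an output register, after a number of steps that is polynomial in the length of the input. -/
theorem polyTimeSolvable_of_runs [Fintype K] {α : Type} {enc : α → List Bool} {p : α → Prop}
    [DecidablePred p] (A : Program K M) (i o : K) (time : Polynomial ℕ)
    (h : ∀ a, Runs A (update (fun _ => []) i (enc a)) (update (fun _ => []) o [decide (p a)])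
      (time.eval (enc a).length)) : PolyTimeSolvable enc p := by
  classical
  refine ⟨⟨⟨toFinTM2 A i o, Equiv.refl Bool, Equiv.refl Bool⟩, time + 1, fun a => ?_⟩⟩
  have h' := Classical.choice (outputs_toFinTM2 (h a))
  have e₀ : (enc a).map (Equiv.refl Bool).invFun = enc a := List.map_id _
  have e₁ : (encodeBool (decide (p a))).map (Equiv.refl Bool).invFun = [decide (p a)] := rfl
  refine cast ?_ h'
  rw [Polynomial.eval_add, Polynomial.eval_one]
  congr 1
  · exact e₀.symm
  · exact congrArg some (e₁.symm.trans (by congr!))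

end Programs

/-! ### Elementary programs on Boolean registers -/

section Basic

variable {K : Type} [DecidableEq K] {M : FinTM2}

theorem Runs.congr {A : Program K M} {T T' U : K → List Bool} {n n' : ℕ} (h : Runs A T U n)
    (hU : U = T') (hn : n ≤ n') : Runs A T T' n' :=
  hU ▸ h.mono hn

/-- Empty the register `k`, executing `A x` after each popped symbol `x`. -/
def drain (k : K) (A : Bool → Program K M) : Program K M :=
  loop k Option.isNone fun o => A (o.getD false)

theorem runs_drain_nil {k : K} {A : Bool → Program K M} {T : K → List Bool} (h : T k = []) :
    Runs (drain k A) T T 1 := by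
  have := runs_loop_end (M := M) (k := k) (isEnd := Option.isNone)
    (A := fun o => A (o.getD false)) (T := T) (by simp [h])
  rwa [h, List.tail_nil, ← h, update_eq_self] at this

theorem runs_drain_cons {k : K} {A : Bool → Program K M} {T T' T'' : K → List Bool} {x : Bool}
    {l : List Bool} {n n' : ℕ} (h : T k = x :: l) (hA : Runs (A x) (update T k l) T' n)
    (hB : Runs (drain k A) T' T'' n') : Runs (drain k A) T T'' (n + n' + 1) :=
  runs_loop_step (by simp [h]) (by simpa [h] using hA) hB

def clear (k : K) : Program K M := drain k fun _ => skip

theorem runs_clear (k : K) (T : K → List Bool) :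
    Runs (M := M) (clear k) T (update T k []) (2 * (T k).length + 1) := by
  generalize h : T k = l
  induction l generalizing T with
  | nil =>
    refine (runs_drain_nil (M := M) h).congr ?_ (by simp)
    rw [← h, update_eq_self]
  | cons x l ih =>
    have := ih (update T k l) (by simp)
    rw [update_idem] at this
    exact (runs_drain_cons h (runs_skip _) this).mono (by simp; omega)

/-- Move the register `k` to `k'`, in reverse order. -/
def move (k k' : K) : Program K M := drain k (push k')

theorem runs_move {k k' : K} (hk : k ≠ k') (T : K → List Bool) :
    Runs (M := M) (move k k') T (update (update T k []) k' ((T k).reverse ++ T k'))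
      (2 * (T k).length + 1) := by
  generalize h : T k = l
  induction l generalizing T with
  | nil =>
    refine (runs_drain_nil (M := M) h).congr ?_ (by simp)
    funext j; simp only [update_apply]; split_ifs <;> simp_all
  | cons x l ih =>
    have := ih (update (update T k l) k' (x :: T k')) (by simp [hk])
    have e : update (update T k []) k' ((x :: l).reverse ++ T k') =
        update (update (update (update T k l) k' (x :: T k')) k []) k'
          (l.reverse ++ (update (update T k l) k' (x :: T k')) k') := by
      funext j; simp only [update_apply]; split_ifs <;> simp_all
    rw [e]
    refine (runs_drain_cons h ?_ this).mono (n := 1 + (2 * l.length + 1) + 1) (by simp; omega)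
    simpa [hk.symm] using runs_push (M := M) k' x (update T k l)

/-- Move the register `k` to both `k'` and `k''`, in reverse order. -/
def moveTwo (k k' k'' : K) : Program K M := drain k fun x => (push k' x).seq (push k'' x)

theorem runs_moveTwo {k k' k'' : K} (hk : k ≠ k') (hk' : k ≠ k'') (hk'' : k' ≠ k'')
    (T : K → List Bool) :
    Runs (M := M) (moveTwo k k' k'') T
      (update (update (update T k []) k' ((T k).reverse ++ T k')) k'' ((T k).reverse ++ T k''))
      (3 * (T k).length + 1) := by
  generalize h : T k = l
  induction l generalizing T with
  | nil =>
    refine (runs_drain_nil (M := M) h).congr ?_ (by simp)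
    funext j; simp only [update_apply]; split_ifs <;> simp_all
  | cons x l ih =>
    have := ih (update (update (update T k l) k' (x :: T k')) k'' (x :: T k''))
      (by simp [hk, hk'])
    have h₁ := runs_push (M := M) k' x (update T k l)
    have h₂ := runs_push (M := M) k'' x (update (update T k l) k' (x :: T k'))
    simp only [update_of_ne hk.symm, update_of_ne hk'.symm, update_of_ne hk''.symm] at h₁ h₂
    refine ((runs_drain_cons h (h₁.seq h₂) this)).congr ?_ (by simp; omega)
    funext j; simp only [update_apply]; split_ifs <;> simp_all

/-- Prepend the register `k` to `k'`, by means of an empty auxiliary register. -/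
def copyTo (aux k k' : K) : Program K M := (move k aux).seq (moveTwo aux k k')

/-- The second pass undoes the reversal caused by the first, and refills `k` on the way. -/
theorem runs_copyTo {aux k k' : K} (hk : k ≠ aux) (hk' : k' ≠ aux) (hk'' : k ≠ k')
    {T : K → List Bool} (h : T aux = []) :
    Runs (M := M) (copyTo aux k k') T (update T k' (T k ++ T k')) (5 * (T k).length + 2) := by
  have h₁ := runs_move (M := M) hk T
  have h₂ := runs_moveTwo (M := M) hk.symm hk'.symm hk''
    (update (update T k []) aux ((T k).reverse ++ T aux))
  refine ((h₁.seq h₂)).congr ?_ (by simp [h]; omega)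
  funext j; simp only [update_apply]; split_ifs <;> simp_all

/-- Cancel the registers `k` and `k'` against each other; what is left of either goes to `d`. -/
def cancel (k k' d : K) : Program K M :=
  (drain k fun _ => popCase k' fun o => o.elim (push d true) fun _ => skip).seq
    (drain k' fun _ => push d true)

/-- At least one truncated difference vanishes, so `d` receives |m - n| symbols. This serves as an
equality test: nothing is written exactly when the numbers agree. -/
theorem runs_cancel {k k' d : K} (hk : k ≠ k') (hd : d ≠ k) (hd' : d ≠ k') {T : K → List Bool}
    {m n : ℕ} (h : T k = List.replicate m true) (h' : T k' = List.replicate n true) :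
    Runs (M := M) (cancel k k' d) T
      (update (update (update T k []) k' []) d
        (List.replicate ((m - n) + (n - m)) true ++ T d)) (3 * m + 2 * n + 2) := by
  have h₁ : Runs (M := M)
      (drain k fun _ => popCase k' fun o => o.elim (push d true) fun _ => skip) T
      (update (update (update T k []) k' (List.replicate (n - m) true)) d
        (List.replicate (m - n) true ++ T d)) (3 * m + 1) := by
    induction m generalizing n T with
    | zero =>
      refine (runs_drain_nil (M := M) h).congr ?_ (by simp)
      funext j; simp only [update_apply]; split_ifs <;> simp_all
    | succ m ih =>
      rw [List.replicate_succ] at h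
      cases n with
      | zero =>
        have h₂ : Runs (M := M) (popCase k' fun o => o.elim (push d true) fun _ => skip)
            (update T k (List.replicate m true))
            (update (update T k (List.replicate m true)) d (true :: T d)) 2 := by
          refine runs_popCase ?_
          have := runs_push (M := M) d true (update T k (List.replicate m true))
          have e : update (update T k (List.replicate m true)) k' [] =
              update T k (List.replicate m true) := by
            funext j; simp only [update_apply]; split_ifs <;> simp_all
          simpa [hk.symm, h', hd, e] using this
        refine ((runs_drain_cons h h₂ (ih (n := 0) (by simp [hd.symm])
          (by simpa [hk.symm, hd'.symm] using h')))).congr ?_ (by omega)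
        funext j; simp only [update_apply]; split_ifs <;>
          simp_all [List.replicate_succ']
      | succ n =>
        have h₂ : Runs (M := M) (popCase k' fun o => o.elim (push d true) fun _ => skip)
            (update T k (List.replicate m true))
            (update (update T k (List.replicate m true)) k' (List.replicate n true)) 2 := by
          refine runs_popCase ?_
          have := runs_skip (M := M)
            (update (update T k (List.replicate m true)) k' (List.replicate n true))
          simpa [hk.symm, h', List.replicate_succ] using this
        refine ((runs_drain_cons h h₂ (ih (n := n) (by simp [hk])
          (by simp)))).congr ?_ (by omega)
        funext j; simp only [update_apply, Nat.succ_sub_succ]; split_ifs <;> simp_all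
  have h₂ : ∀ (l : List Bool) (T : K → List Bool), T k' = l →
      Runs (M := M) (drain k' fun _ => push d true) T
        (update (update T k' []) d (List.replicate l.length true ++ T d)) (2 * l.length + 1) := by
    intro l
    induction l with
    | nil =>
      intro T h
      refine (runs_drain_nil (M := M) h).congr ?_ (by simp)
      funext j; simp only [update_apply]; split_ifs <;> simp_all
    | cons x l ih =>
      intro T h
      have := runs_push (M := M) d true (update T k' l)
      rw [update_of_ne hd'] at this
      refine ((runs_drain_cons h this (ih _ (by simp [hd'.symm])))).congr ?_ (by simp; omega)
      funext j; simp only [update_apply]; split_ifs <;>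
        simp_all [List.replicate_succ']
  refine ((h₁.seq (h₂ _ _ (by simp [hd'.symm]; rfl)))).congr ?_ (by simp; omega)
  funext j; simp only [update_apply]; split_ifs <;> simp_all
  rw [← List.append_assoc, ← List.replicate_add, Nat.add_comm]

/-- Move a field from the register `k` to `k'`, without its end marker. -/
def readField (k k' : K) : Program K M := loop k (· != some true) fun _ => push k' true

theorem unaryEncodeNat_eq (n : ℕ) : unaryEncodeNat n = List.replicate n true := by
  induction n with
  | zero => rfl
  | succ n ih => rw [unaryEncodeNat, ih, List.replicate_succ]

theorem encodeField_eq (n : ℕ) : encodeField n = List.replicate n true ++ [false] := by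
  rw [encodeField, unaryEncodeNat_eq]

theorem runs_readField {k k' : K} (hk : k ≠ k') {T : K → List Bool} {n : ℕ} {l : List Bool}
    (h : T k = encodeField n ++ l) :
    Runs (M := M) (readField k k') T
      (update (update T k l) k' (List.replicate n true ++ T k')) (2 * n + 1) := by
  rw [encodeField_eq] at h
  induction n generalizing T with
  | zero =>
    refine (runs_loop_end (M := M) (k := k) (T := T) (isEnd := (· != some true))
      (by simp [h])).congr ?_ (by simp)
    funext j; simp only [update_apply]; split_ifs <;> simp_all
  | succ n ih =>
    have := runs_push (M := M) k' true (update T k (T k).tail)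
    refine ((runs_loop_step (M := M) (k := k) (T := T) (isEnd := (· != some true))
      (by simp [h, List.replicate_succ]) this (ih (by simp [hk, h, List.replicate_succ])))).congr ?_ (by omega)
    funext j; simp only [update_apply]; split_ifs <;> simp_all [List.replicate_succ']

def clearAll : List K → Program K M
  | [] => skip
  | k :: ks => (clear k).seq (clearAll ks)

/-- Prepend a fixed word to the register `k`. -/
def prependWord (k : K) : List Bool → Program K M
  | [] => skip
  | x :: l => (prependWord k l).seq (push k x)

theorem runs_prependWord (k : K) (l : List Bool) (T : K → List Bool) :
    Runs (M := M) (prependWord k l) T (update T k (l ++ T k)) (l.length + 1) := by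
  induction l with
  | nil => exact (runs_skip (M := M) T).congr (by simp) (by simp)
  | cons x l ih =>
    exact (ih.seq (runs_push (M := M) k x (update T k (l ++ T k)))).congr (by simp) (by simp)

end Basic

/-! ### Polynomial bounds -/

section Polynomial

variable {ι : Type} {size f f' : ι → ℕ}

/-- The coefficients are natural numbers, so bounds may be substituted into one another. -/
theorem eval_mono (p : Polynomial ℕ) : Monotone fun n => p.eval n := by
  intro m n h
  simp only [Polynomial.eval_eq_sum_range]
  gcongr

def PolyBounded (size f : ι → ℕ) : Prop := ∃ p : Polynomial ℕ, ∀ i, f i ≤ p.eval (size i)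

theorem PolyBounded.const (n : ℕ) : PolyBounded size fun _ => n := ⟨.C n, by simp⟩

theorem PolyBounded.of_le_size (h : ∀ i, f i ≤ size i) : PolyBounded size f := ⟨.X, by simpa⟩

theorem PolyBounded.mono (hf : PolyBounded size f') (h : ∀ i, f i ≤ f' i) : PolyBounded size f :=
  let ⟨p, hp⟩ := hf
  ⟨p, fun i => (h i).trans (hp i)⟩

theorem PolyBounded.add (hf : PolyBounded size f) (hf' : PolyBounded size f') :
    PolyBounded size fun i => f i + f' i :=
  let ⟨p, hp⟩ := hf
  let ⟨p', hp'⟩ := hf'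
  ⟨p + p', fun i => by simpa using Nat.add_le_add (hp i) (hp' i)⟩

theorem PolyBounded.mul (hf : PolyBounded size f) (hf' : PolyBounded size f') :
    PolyBounded size fun i => f i * f' i :=
  let ⟨p, hp⟩ := hf
  let ⟨p', hp'⟩ := hf'
  ⟨p * p', fun i => by simpa using Nat.mul_le_mul (hp i) (hp' i)⟩

theorem PolyBounded.eval (p : Polynomial ℕ) (hf : PolyBounded size f) :
    PolyBounded size fun i => p.eval (f i) :=
  let ⟨q, hq⟩ := hf
  ⟨p.comp q, fun i => by rw [Polynomial.eval_comp]; exact eval_mono p (hq i)⟩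

theorem PolyBounded.comp (hf : PolyBounded size f) {ι' : Type} (g : ι' → ι) :
    PolyBounded (fun i => size (g i)) fun i => f (g i) :=
  let ⟨p, hp⟩ := hf
  ⟨p, fun i => hp (g i)⟩

theorem PolyBounded.listSum {κ : Type} {F : κ → ι → ℕ} (ks : List κ)
    (h : ∀ k, PolyBounded size (F k)) : PolyBounded size fun i => (ks.map (F · i)).sum := by
  induction ks with
  | nil => exact .const 0
  | cons k ks ih => simpa using (h k).add ih

variable {K : Type} [DecidableEq K] {M : FinTM2}

/-- The program transforms the registers from `T i` to `T' i`, in a time that is polynomial in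
the size of the index `i`. -/
def PolyRuns (size : ι → ℕ) (A : Program K M) (T T' : ι → K → List Bool) : Prop :=
  ∃ p : Polynomial ℕ, ∀ i, Runs A (T i) (T' i) (p.eval (size i))

variable {A B : Program K M} {T T' T'' : ι → K → List Bool}

theorem PolyRuns.of_runs (hf : PolyBounded size f) (h : ∀ i, Runs A (T i) (T' i) (f i)) :
    PolyRuns size A T T' :=
  let ⟨p, hp⟩ := hf
  ⟨p, fun i => (h i).mono (hp i)⟩

theorem PolyRuns.seq (hA : PolyRuns size A T T') (hB : PolyRuns size B T' T'') :
    PolyRuns size (A.seq B) T T'' :=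
  let ⟨p, hp⟩ := hA
  let ⟨q, hq⟩ := hB
  ⟨p + q, fun i => by simpa using (hp i).seq (hq i)⟩

theorem PolyRuns.comp (hA : PolyRuns size A T T') {ι' : Type} (g : ι' → ι) :
    PolyRuns (fun i => size (g i)) A (fun i => T (g i)) fun i => T' (g i) :=
  let ⟨p, hp⟩ := hA
  ⟨p, fun i => hp (g i)⟩

theorem PolyRuns.congr (hA : PolyRuns size A T T') {U U' : ι → K → List Bool}
    (h : ∀ i, T i = U i) (h' : ∀ i, T' i = U' i) : PolyRuns size A U U' := by
  rwa [← funext h, ← funext h']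

theorem PolyRuns.popCase {k : K} {A : Option Bool → Program K M}
    (h : ∀ o, PolyRuns (fun i : {i // (T i k).head? = o} => size i) (A o)
      (fun i => update (T i) k (T i k).tail) fun i => T' i) :
    PolyRuns size (popCase k A) T T' := by
  choose p hp using h
  -- Each of the three outcomes of the pop has its own polynomial; the sum dominates all of them,
  -- and the pop itself is one more step.
  refine ⟨∑ o, p o + 1, fun i => (runs_popCase (hp _ ⟨i, rfl⟩)).mono ?_⟩
  simp only [Polynomial.eval_add, Polynomial.eval_finsetSum, Polynomial.eval_one]
  gcongr
  exact Finset.single_le_sum (f := fun o => (p o).eval (size i)) (fun _ _ => Nat.zero_le _)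
    (Finset.mem_univ _)

theorem PolyRuns.clearAll (ks : List K) (h : ∀ k, PolyBounded size fun i => (T i k).length) :
    PolyRuns (M := M) size (clearAll ks) T fun i k => if k ∈ ks then [] else T i k := by
  induction ks generalizing T with
  | nil =>
    exact .of_runs (.const 1) fun i => (runs_skip (M := M) (T i)).congr (by simp) le_rfl
  | cons k ks ih =>
    have h₁ := PolyRuns.of_runs (((PolyBounded.const 2).mul (h k)).add (.const 1))
      fun i => runs_clear (M := M) k (T i)
    have h₂ := ih (T := fun i => update (T i) k []) fun k' => (h k').mono fun i => by
      by_cases e : k' = k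
      · subst e; simp
      · simp [e]
    refine (h₁.seq h₂).congr (fun _ => rfl) fun i => ?_
    funext j
    by_cases e : j = k
    · subst e; simp
    · simp [e]

end Polynomial

/-! ### Exhaustive search over bounded counters -/

/-- The registers of a search program with counters in `κ`. -/
inductive Reg (κ : Type)
  | input | first | target | word | aux | left | right | diff | bad | flag | output
  | val (k : κ)
  | rem (k : κ)
  deriving DecidableEq, Fintype

section Search

variable {κ : Type} [DecidableEq κ] {M : FinTM2}

/-- The registers during a search: an instance consists of a bound `n` for the counters, a number
`g` and a word `w`; `b` tells whether the search has succeeded yet, and `c` are the counters. -/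
def searchState (n g : ℕ) (w : List Bool) (b : Bool) (c : κ → ℕ) : Reg κ → List Bool
  | .input => w
  | .first => List.replicate n true
  | .target => List.replicate g true
  | .flag => if b then [true] else []
  | .val k => List.replicate (c k) true
  | .rem k => List.replicate (n - c k) true
  | _ => []

/-- An instance, together with the success of the search so far, and bounded counters. -/
structure SearchIndex (κ : Type) {α : Type} (n : α → ℕ) where
  inst : α
  found : Bool
  count : κ → ℕ
  count_le : ∀ k, count k ≤ n inst

variable {α : Type} {n g : α → ℕ} {w : α → List Bool}

def SearchIndex.state (g : α → ℕ) (w : α → List Bool) (i : SearchIndex κ n) :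
    Reg κ → List Bool :=
  searchState (n i.inst) (g i.inst) (w i.inst) i.found i.count

def SearchIndex.size (g : α → ℕ) (w : α → List Bool) (i : SearchIndex κ n) : ℕ :=
  n i.inst + g i.inst + (w i.inst).length

/-- Execute `A` for all values of the counters in `ks`. -/
def search (A : Program (Reg κ) M) : List κ → Program (Reg κ) M
  | [] => A
  | k :: ks => ((search A ks).seq
      (drain (.rem k) fun _ => (push (.val k) true).seq (search A ks))).seq
      (move (.val k) (.rem k))

-- Induction on the nesting of the loops. The counters in `ks` start and end at zero, while the
-- others are held fixed by the enclosing loops. Each loop multiplies the time by a factor about `n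
-- + 1`; the number of loops does not depend on the instance, so the time stays polynomial.
open scoped Classical in
theorem polyRuns_search {A : Program (Reg κ) M} {R : α → (κ → ℕ) → Prop}
    (hA : PolyRuns (SearchIndex.size g w) A (SearchIndex.state (n := n) g w)
      fun i => searchState (n i.inst) (g i.inst) (w i.inst)
        (i.found || decide (R i.inst i.count)) i.count) (ks : List κ) (hks : ks.Nodup) :
    PolyRuns (fun i : {i : SearchIndex κ n // ∀ k ∈ ks, i.count k = 0} => i.1.size g w)
      (search A ks) (fun i => i.1.state g w)
      fun i => searchState (n i.1.inst) (g i.1.inst) (w i.1.inst)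
        (i.1.found || decide (∃ c : κ → ℕ, (∀ k ∉ ks, c k = i.1.count k) ∧
          (∀ k, c k ≤ n i.1.inst) ∧ R i.1.inst c)) i.1.count := by
  induction ks with
  | nil =>
    refine (hA.comp Subtype.val).congr (fun _ => rfl) fun i => ?_
    congr 3
    refine propext ⟨fun h => ⟨i.1.count, by simp, i.1.count_le, h⟩, ?_⟩
    rintro ⟨c, hc, -, h⟩
    obtain rfl : c = i.1.count := funext fun k => hc k (by simp)
    exact h
  | cons k ks ih =>
    obtain ⟨hk, hks⟩ := List.nodup_cons.1 hks
    obtain ⟨p, hp⟩ := ih hks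
    let Q (a : α) (c : κ → ℕ) : Prop := ∃ c' : κ → ℕ, (∀ k ∉ ks, c' k = c k) ∧
      (∀ k, c' k ≤ n a) ∧ R a c'
    replace hp : ∀ (a : α) (b : Bool) (c : κ → ℕ), (∀ k, c k ≤ n a) → (∀ k ∈ ks, c k = 0) →
        Runs (search A ks) (searchState (n a) (g a) (w a) b c)
          (searchState (n a) (g a) (w a) (b || decide (Q a c)) c)
          (p.eval (n a + g a + (w a).length)) :=
      fun a b c hc hc' => hp ⟨⟨a, b, c, hc⟩, hc'⟩
    -- Induction on the supply left in `.rem k`: the loop tries the values above the current one and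
    -- ends with the counter at its bound.
    have hloop : ∀ (d : ℕ) (a : α) (b : Bool) (c : κ → ℕ), (∀ k, c k ≤ n a) →
        (∀ k ∈ ks, c k = 0) → n a - c k = d →
        Runs (drain (.rem k) fun _ => (push (.val k) true).seq (search A ks))
          (searchState (n a) (g a) (w a) b c)
          (searchState (n a) (g a) (w a)
            (b || decide (∃ j, c k < j ∧ j ≤ n a ∧ Q a (update c k j))) (update c k (n a)))
          (d * (p.eval (n a + g a + (w a).length) + 2) + 1) := by
      intro d
      induction d with
      | zero =>
        intro a b c hc hc' hd
        have hck : c k = n a := le_antisymm (hc k) (by omega)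
        refine (runs_drain_nil (by simp [searchState, hd])).congr ?_ (by simp)
        have : ¬ ∃ j, c k < j ∧ j ≤ n a ∧ Q a (update c k j) := by
          rintro ⟨j, h, h', -⟩; omega
        rw [decide_eq_false this, Bool.or_false, ← hck, update_eq_self]
      | succ d ihd =>
        intro a b c hc hc' hd
        have hc₁ : ∀ k', update c k (c k + 1) k' ≤ n a := by
          intro k'
          by_cases e : k' = k
          · subst e; simp; omega
          · simp [e, hc]
        have hc₁' : ∀ k' ∈ ks, update c k (c k + 1) k' = 0 := by
          intro k' hk'
          have e : k' ≠ k := by rintro rfl; exact hk hk'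
          simp [e, hc' k' hk']
        have h₁ := (runs_push (M := M) (.val k) true (update (searchState (n a) (g a) (w a) b c)
          (.rem k) (List.replicate d true))).congr
            (T' := searchState (n a) (g a) (w a) b (update c k (c k + 1))) (by
            funext j
            rcases j with _ | _ | _ | _ | _ | _ | _ | _ | _ | _ | _ | k' | k' <;>
              simp [searchState, update_apply]
            · split_ifs with e
              · subst e; simp [List.replicate_succ]
              · rfl
            · split_ifs with e
              · congr 1; omega
              · rfl) le_rfl
        have h₂ := hp a b _ hc₁ hc₁'
        have h₃ := ihd a (b || decide (Q a (update c k (c k + 1)))) _ hc₁ hc₁' (by simp; omega)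
        refine (runs_drain_cons (x := true) (l := List.replicate d true)
          (by simp [searchState, hd, List.replicate_succ]) (h₁.seq h₂) h₃).congr ?_ (by ring_nf; omega)
        simp only [update_idem, update_self]
        congr 1
        rw [Bool.or_assoc]
        congr 1
        rw [← Bool.decide_or]
        congr 1
        refine propext ⟨?_, ?_⟩
        · rintro (h | ⟨j, h, h', h''⟩)
          · exact ⟨c k + 1, by omega, by omega, h⟩
          · exact ⟨j, by omega, h', h''⟩
        · rintro ⟨j, h, h', h''⟩
          rcases Nat.lt_or_ge (c k + 1) j with e | e
          · exact .inr ⟨j, e, h', h''⟩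
          · obtain rfl : j = c k + 1 := by omega
            exact .inl h''
    refine .of_runs (f := fun i => p.eval (i.1.size g w) +
      (n i.1.inst * (p.eval (i.1.size g w) + 2) + 1) + (2 * n i.1.inst + 1)) ?_ ?_
    · have h₁ : PolyBounded (fun i : {i : SearchIndex κ n // ∀ k' ∈ k :: ks, i.count k' = 0} =>
          i.1.size g w) fun i => n i.1.inst := .of_le_size fun i => by
            simp only [SearchIndex.size]; omega
      have h₂ : PolyBounded (fun i : {i : SearchIndex κ n // ∀ k' ∈ k :: ks, i.count k' = 0} =>
          i.1.size g w) fun i => p.eval (i.1.size g w) := .eval p (.of_le_size fun _ => le_rfl)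
      exact (h₂.add ((h₁.mul (h₂.add (.const 2))).add (.const 1))).add
        (((PolyBounded.const 2).mul h₁).add (.const 1))
    · rintro ⟨⟨a, b, c, hc⟩, hc'⟩
      have hck : c k = 0 := hc' k (by simp)
      have hcs : ∀ k ∈ ks, c k = 0 := fun k hk => hc' k (by simp [hk])
      have h₁ := hp a b c hc hcs
      have h₂ := hloop (n a) a (b || decide (Q a c)) c hc hcs (by omega)
      -- The counter stands at `n a`; moving it back to `.rem k` resets it to zero for the next pass
      -- of an enclosing loop.
      have h₃ := runs_move (M := M) (k := Reg.val k) (k' := .rem k) (by simp)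
        (searchState (n a) (g a) (w a) ((b || decide (Q a c)) ||
          decide (∃ j, c k < j ∧ j ≤ n a ∧ Q a (update c k j))) (update c k (n a)))
      refine ((h₁.seq h₂).seq h₃).congr ?_ (by simp [searchState, SearchIndex.size])
      have hb : (((b || decide (Q a c)) ||
          decide (∃ j, c k < j ∧ j ≤ n a ∧ Q a (update c k j)))) =
          (b || decide (∃ c' : κ → ℕ, (∀ k' ∉ k :: ks, c' k' = c k') ∧
            (∀ k, c' k ≤ n a) ∧ R a c')) := by
        rw [Bool.or_assoc]
        congr 1
        rw [← Bool.decide_or]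
        congr 1
        refine propext ⟨?_, ?_⟩
        · rintro (⟨c', h, h'⟩ | ⟨j, -, -, c', h, h'⟩)
          · exact ⟨c', fun k' hk' => h k' fun e => hk' (by simp [e]), h'⟩
          · refine ⟨c', fun k' hk' => ?_, h'⟩
            rw [List.mem_cons, not_or] at hk'
            rw [h k' hk'.2, update_of_ne hk'.1]
        · rintro ⟨c', h, h', h''⟩
          have key : Q a (update c k (c' k)) := by
            refine ⟨c', fun k' hk' => ?_, h', h''⟩
            by_cases e : k' = k
            · subst e; simp
            · rw [update_of_ne e, h k' (by simp [e, hk'])]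
          -- The value zero is covered by the search that precedes the loop, positive values by the
          -- loop.
          rcases Nat.eq_zero_or_pos (c' k) with e | e
          · left
            rwa [e, ← hck, update_eq_self] at key
          · exact .inr ⟨c' k, by omega, h' k, key⟩
      rw [hb]
      funext j
      rcases j with _ | _ | _ | _ | _ | _ | _ | _ | _ | _ | _ | k' | k' <;>
        simp [searchState, update_apply]
      · split_ifs with e
        · subst e; simp [hck]
        · rfl
      · split_ifs with e
        · subst e; simp [hck]
        · rfl

end Search

theorem PolyRuns.mono_size {ι K : Type} [DecidableEq K] {M : FinTM2} {size size' : ι → ℕ}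
    {A : Program K M} {T T' : ι → K → List Bool} (hA : PolyRuns size A T T')
    (h : ∀ i, size i ≤ size' i) : PolyRuns size' A T T' :=
  let ⟨p, hp⟩ := hA
  ⟨p, fun i => (hp i).mono (eval_mono p (h i))⟩

/-! ### One round of the search: a single call of the subroutine -/

section Attempt

variable {κ : Type} [DecidableEq κ] {M : FinTM2}
variable {α : Type} {n g : α → ℕ} {w : α → List Bool}

/-- Check the counters; if they are valid, build a word, run the subroutine on it, and compare its
output with the target. -/
def attempt (e₀ : M.Γ M.k₀ ≃ Bool) (e₁ : M.Γ M.k₁ ≃ Bool) (check build : Program (Reg κ) M) :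
    Program (Reg κ) M :=
  check.seq <| popCase .bad fun o => o.elim
    (build.seq <| (move .word .aux).seq <| (call e₀ e₁ .aux .left).seq <|
      (copyTo .aux .target .right).seq <| (cancel .left .right .bad).seq <|
      popCase .bad fun o => o.elim ((clear .flag).seq (push .flag true)) fun _ => clear .bad)
    fun _ => clear .bad

-- The test must come before the call: the subroutine is only known to halt, in time and with a
-- meaningful output, on words that come from valid counters. Both the test and the final comparison
-- report failure by a nonempty `.bad`, which is emptied again.
open scoped Classical in
theorem polyRuns_attempt {e₀ : M.Γ M.k₀ ≃ Bool} {e₁ : M.Γ M.k₁ ≃ Bool}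
    {check build : Program (Reg κ) M} {x : SearchIndex κ n → List Bool}
    {valid : α → (κ → ℕ) → Prop} {word : α → (κ → ℕ) → List Bool} {out : α → (κ → ℕ) → ℕ}
    (hx : PolyBounded (SearchIndex.size g w) fun i => (x i).length)
    (hvalid : ∀ i, x i = [] ↔ valid i.inst i.count)
    (hcheck : PolyRuns (SearchIndex.size g w) check (SearchIndex.state g w)
      fun i => update (i.state g w) .bad (x i))
    (hbuild : PolyRuns (SearchIndex.size g w) build (SearchIndex.state (n := n) g w)
      fun i => update (i.state g w) .word (word i.inst i.count))
    (hword : PolyBounded (SearchIndex.size (n := n) g w) fun i => (word i.inst i.count).length)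
    (hout : PolyBounded (SearchIndex.size (n := n) g w) fun i => out i.inst i.count)
    (time : Polynomial ℕ)
    (hM : ∀ i : SearchIndex κ n, valid i.inst i.count →
      Nonempty (TM2OutputsInTime M ((word i.inst i.count).map e₀.symm)
        (some ((unaryEncodeNat (out i.inst i.count)).map e₁.symm))
        (time.eval (word i.inst i.count).length))) :
    PolyRuns (SearchIndex.size g w) (attempt e₀ e₁ check build)
      (SearchIndex.state (n := n) g w)
      fun i => searchState (n i.inst) (g i.inst) (w i.inst)
        (i.found || decide (valid i.inst i.count ∧ out i.inst i.count = g i.inst)) i.count := by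
  have hbad : ∀ i : SearchIndex κ n, update (i.state g w) .bad [] = i.state g w :=
    fun i => update_eq_self _ _
  refine hcheck.seq (.popCase fun o => ?_)
  cases o with
  | some y =>
    refine .of_runs (A := clear Reg.bad) (((PolyBounded.const 2).mul hx).add (.const 1) |>.comp
      Subtype.val) fun ⟨i, hi⟩ => (runs_clear Reg.bad _).congr ?_ ?_
    · have : ¬ (valid i.inst i.count ∧ out i.inst i.count = g i.inst) := by
        intro h
        rw [update_self, (hvalid i).2 h.1] at hi
        cases hi
      rw [decide_eq_false this, Bool.or_false, update_idem, update_idem, hbad]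
      rfl
    · simp
  | none =>
    let I := {i : SearchIndex κ n // (update (i.state g w) .bad (x i) .bad).head? = none}
    have hxi : ∀ i : I, x i.1 = [] := fun i => by simpa using i.2
    have hv : ∀ i : I, valid i.1.inst i.1.count := fun i => (hvalid _).1 (hxi i)
    have hword' := hword.comp (fun i : I => i.1)
    have hout' := hout.comp (fun i : I => i.1)
    have hg : PolyBounded (fun i : I => i.1.size g w) fun i => g i.1.inst :=
      .of_le_size fun i => by simp only [SearchIndex.size]; omega
    have h₁ : PolyRuns (fun i : I => i.1.size g w) build
        (fun i : I => update (update (i.1.state g w) .bad (x i.1)) .bad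
          (update (i.1.state g w) .bad (x i.1) .bad).tail)
        fun i => update (i.1.state g w) .word (word i.1.inst i.1.count) :=
      (hbuild.comp (fun i : I => i.1)).congr (fun i => by simp [hxi i, hbad]) fun _ => rfl
    -- `call` feeds the reversal of its register to the subroutine, so the word is reversed
    -- beforehand.
    have h₂ : PolyRuns (M := M) (fun i : I => i.1.size g w) (move .word .aux)
        (fun i : I => update (i.1.state g w) .word (word i.1.inst i.1.count))
        fun i => update (i.1.state g w) .aux (word i.1.inst i.1.count).reverse := by
      refine .of_runs (((PolyBounded.const 2).mul hword').add (.const 1))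
        fun i => (runs_move (by simp) _).congr ?_ (by simp)
      funext r
      simp only [update_apply]
      split_ifs <;> simp_all [SearchIndex.state, searchState]
    have h₃ : PolyRuns (fun i : I => i.1.size g w) (call e₀ e₁ .aux .left)
        (fun i : I => update (i.1.state g w) .aux (word i.1.inst i.1.count).reverse)
        fun i => update (i.1.state g w) .left (List.replicate (out i.1.inst i.1.count) true) := by
      refine .of_runs (((((PolyBounded.const 2).mul hword').add (.const 1)).add
        (hword'.eval time)).add (((PolyBounded.const 2).mul hout').add (.const 1)))
        fun i => (runs_call (by simp) (by simp [SearchIndex.state, searchState]) (by simp)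
          (hM i.1 (hv i)).some).congr ?_ (by simp [unaryEncodeNat_eq])
      funext r
      simp only [update_apply]
      split_ifs <;> simp_all [SearchIndex.state, searchState, unaryEncodeNat_eq]
    have h₄ : PolyRuns (M := M) (fun i : I => i.1.size g w) (copyTo .aux .target .right)
        (fun i : I => update (i.1.state g w) .left (List.replicate (out i.1.inst i.1.count) true))
        fun i => update (update (i.1.state g w) .left
          (List.replicate (out i.1.inst i.1.count) true)) .right
          (List.replicate (g i.1.inst) true) := by
      refine .of_runs (((PolyBounded.const 5).mul hg).add (.const 2))
        fun i => (runs_copyTo (by simp) (by simp) (by simp)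
          (by simp [SearchIndex.state, searchState])).congr ?_ ?_
      all_goals simp [SearchIndex.state, searchState]
    have h₅ : PolyRuns (M := M) (fun i : I => i.1.size g w) (cancel .left .right .bad)
        (fun i : I => update (update (i.1.state g w) .left
          (List.replicate (out i.1.inst i.1.count) true)) .right
          (List.replicate (g i.1.inst) true))
        fun i => update (i.1.state g w) .bad (List.replicate
          ((out i.1.inst i.1.count - g i.1.inst) + (g i.1.inst - out i.1.inst i.1.count)) true) := by
      refine .of_runs ((((PolyBounded.const 3).mul hout').add
        ((PolyBounded.const 2).mul hg)).add (.const 2))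
        fun i => (runs_cancel (by simp) (by simp) (by simp) (by simp) (by simp)).congr
          ?_ le_rfl
      funext r
      simp only [update_apply]
      split_ifs <;> simp_all [SearchIndex.state, searchState]
    refine h₁.seq <| h₂.seq <| h₃.seq <| h₄.seq <| h₅.seq <| .popCase fun o => ?_
    cases o with
    | none =>
      -- Clearing first keeps `.flag` at one symbol even after repeated success. It takes at most
      -- three steps, the push one more.
      refine .of_runs (A := (clear Reg.flag).seq (push Reg.flag true)) (.const 4) fun ⟨i, hi⟩ =>
        ((runs_clear Reg.flag _).seq (runs_push Reg.flag true _)).congr ?_ ?_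
      · have h : out i.1.inst i.1.count = g i.1.inst := by
          rw [update_self, List.head?_eq_none_iff, List.replicate_eq_nil_iff] at hi
          omega
        rw [decide_eq_true ⟨hv i, h⟩, Bool.or_true]
        funext r
        simp only [update_apply]
        split_ifs <;> simp_all [SearchIndex.state, searchState]
        cases r <;> simp_all
      · simp [SearchIndex.state, searchState]
        cases i.1.found <;> simp
    | some y =>
      refine .of_runs (A := clear Reg.bad) ((((PolyBounded.const 2).mul (hout'.add hg)).add
        (.const 1)).comp Subtype.val) fun ⟨i, hi⟩ => (runs_clear Reg.bad _).congr ?_ ?_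
      · have h : ¬ (valid i.1.inst i.1.count ∧ out i.1.inst i.1.count = g i.1.inst) := by
          intro h
          rw [h.2, update_self] at hi
          simp at hi
        rw [decide_eq_false h, Bool.or_false, update_idem, update_idem, hbad]
        rfl
      · simp
        omega

end Attempt

/-! ### From the search to a polynomial-time decision procedure -/

section Main

variable {κ : Type} [DecidableEq κ] {M : FinTM2}

/-- Initialize the supplies of the counters in `ks` by their bound. -/
def initCounters : List κ → Program (Reg κ) M
  | [] => skip
  | k :: ks => (initCounters ks).seq (copyTo .aux .first (.rem k))

/-- Interpolates between the state after parsing, where no supply is filled, and the start of the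
search, where all counters are zero with full supplies. -/
def initialState (n g : ℕ) (w : List Bool) (ks : List κ) : Reg κ → List Bool
  | .rem k => if k ∈ ks then List.replicate n true else []
  | r => searchState n g w false 0 r

theorem runs_initCounters (n g : ℕ) (w : List Bool) (ks : List κ) (hks : ks.Nodup) :
    Runs (M := M) (initCounters ks) (initialState n g w [])
      (initialState n g w ks) (ks.length * (5 * n + 2) + 1) := by
  induction ks with
  | nil => exact (runs_skip _).mono (by simp)
  | cons k ks ih =>
    obtain ⟨hk, hks⟩ := List.nodup_cons.1 hks
    refine ((ih hks).seq (runs_copyTo (by simp) (by simp) (by simp) rfl)).congr ?_ ?_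
    · funext r
      rcases r with _ | _ | _ | _ | _ | _ | _ | _ | _ | _ | _ | k' | k' <;>
        simp [initialState, searchState, update_apply]
      by_cases e : k' = k
      · subst e; simp [hk]
      · simp [e]
    · simp [initialState, searchState]
      ring_nf
      omega

/-- Parse an instance, execute `A` for all values of the counters, clean up, and write the
answer. -/
noncomputable def searchProgram [Fintype κ] (A : Program (Reg κ) M) : Program (Reg κ) M :=
  (readField .input .first).seq <| (readField .input .target).seq <|
  (initCounters Finset.univ.toList).seq <| (search A Finset.univ.toList).seq <|
  (clearAll ({.flag}ᶜ : Finset (Reg κ)).toList).seq <|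
  popCase .flag fun o => push .output o.isSome

-- The first field of the input doubles as the bound of all counters. After the search every
-- register except `.flag` is erased, because only the output may remain when the machine halts.
open scoped Classical in
theorem polyTimeSolvable_search [Fintype κ] {α : Type} {n g : α → ℕ} {w enc : α → List Bool}
    (henc : ∀ a, enc a = encodeField (n a) ++ (encodeField (g a) ++ w a))
    {A : Program (Reg κ) M} {R : α → (κ → ℕ) → Prop}
    (hA : PolyRuns (SearchIndex.size g w) A (SearchIndex.state (n := n) g w)
      fun i => searchState (n i.inst) (g i.inst) (w i.inst)
        (i.found || decide (R i.inst i.count)) i.count) :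
    PolyTimeSolvable enc fun a => ∃ c : κ → ℕ, (∀ k, c k ≤ n a) ∧ R a c := by
  let P (a : α) : Prop := ∃ c : κ → ℕ, (∀ k, c k ≤ n a) ∧ R a c
  have hlen : ∀ a, (enc a).length = n a + 1 + (g a + 1 + (w a).length) := fun a => by
    simp [henc, encodeField_eq]; omega
  have hn : PolyBounded (fun a => (enc a).length) n := .of_le_size fun a => by rw [hlen]; omega
  have hg : PolyBounded (fun a => (enc a).length) g := .of_le_size fun a => by rw [hlen]; omega
  have hw : PolyBounded (fun a => (enc a).length) fun a => (w a).length :=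
    .of_le_size fun a => by rw [hlen]; omega
  have h₁ : PolyRuns (M := M) (fun a => (enc a).length) (readField .input .first)
      (fun a => update (fun _ : Reg κ => []) .input (enc a))
      fun a => update (update (fun _ => []) .input (encodeField (g a) ++ w a)) .first
        (List.replicate (n a) true) :=
    .of_runs (((PolyBounded.const 2).mul hn).add (.const 1)) fun a =>
      (runs_readField (by simp) (by rw [update_self]; exact henc a)).congr (by simp) le_rfl
  have h₂ : PolyRuns (M := M) (fun a => (enc a).length) (readField .input .target)
      (fun a => update (update (fun _ : Reg κ => []) .input (encodeField (g a) ++ w a)) .first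
        (List.replicate (n a) true))
      fun a => initialState (n a) (g a) (w a) [] := by
    refine .of_runs (((PolyBounded.const 2).mul hg).add (.const 1)) fun a =>
      (runs_readField (by simp) (by simp; rfl)).congr ?_ le_rfl
    funext r
    cases r <;> simp [initialState, searchState]
  have h₃ : PolyRuns (M := M) (fun a => (enc a).length) (initCounters Finset.univ.toList)
      (fun a => initialState (n a) (g a) (w a) [])
      fun a => searchState (n a) (g a) (w a) false (0 : κ → ℕ) := by
    refine .of_runs (((PolyBounded.const (Finset.univ.toList (α := κ)).length).mul
      (((PolyBounded.const 5).mul hn).add (.const 2))).add (.const 1)) fun a =>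
      (runs_initCounters _ _ _ _ (Finset.nodup_toList _)).congr ?_ le_rfl
    funext r
    cases r <;> simp [initialState, searchState]
  have h₄ : PolyRuns (fun a => (enc a).length) (search A Finset.univ.toList)
      (fun a => searchState (n a) (g a) (w a) false (0 : κ → ℕ))
      fun a => searchState (n a) (g a) (w a) (decide (P a)) (0 : κ → ℕ) := by
    refine (((polyRuns_search hA _ (Finset.nodup_toList _)).comp fun a =>
      ⟨⟨a, false, 0, fun _ => Nat.zero_le _⟩, fun _ _ => rfl⟩).mono_size fun a => ?_).congr
        (fun _ => rfl) fun a => ?_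
    · simp only [SearchIndex.size, hlen]; omega
    · simp [P]
  have h₅ := PolyRuns.clearAll (M := M) (size := fun a => (enc a).length)
    (T := fun a => searchState (n a) (g a) (w a) (decide (P a)) (0 : κ → ℕ))
    ({.flag}ᶜ : Finset (Reg κ)).toList fun r => by
      cases r
      case input => exact hw
      case first => exact hn.mono fun a => by simp [searchState]
      case target => exact hg.mono fun a => by simp [searchState]
      case flag => exact (PolyBounded.const 1).mono fun a => by simp [searchState]; split <;> simp
      case rem => exact hn.mono fun a => by simp [searchState]
      all_goals exact (PolyBounded.const 0).mono fun a => by simp [searchState]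
  have h₆ : PolyRuns (M := M) (fun a => (enc a).length)
      (popCase .flag fun o => push .output o.isSome)
      (fun a r => if r ∈ ({.flag}ᶜ : Finset (Reg κ)).toList then [] else
        searchState (n a) (g a) (w a) (decide (P a)) (0 : κ → ℕ) r)
      fun a => update (fun _ => []) .output [decide (P a)] := by
    refine .of_runs (.const 2) fun a => (runs_popCase (runs_push _ _ _)).congr ?_ le_rfl
    funext r
    by_cases h : P a <;> cases r <;> simp [h, searchState]
  obtain ⟨p, hp⟩ := h₁.seq <| h₂.seq <| h₃.seq <| h₄.seq <| h₅.seq h₆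
  exact polyTimeSolvable_of_runs (searchProgram A) .input .output p hp

end Main

/-! ### Iteration over a fixed list and repetition of words -/

section ForAll

variable {K κ ι : Type} [DecidableEq K] {M : FinTM2}

/-- Execute `f k` for all `k` in a list, the last one first. -/
def forAll (f : κ → Program K M) : List κ → Program K M
  | [] => skip
  | k :: ks => (forAll f ks).seq (f k)

/-- Words are prepended, so treating the last element first leaves them in the order of the list. -/
theorem PolyRuns.forAll {size : ι → ℕ} {f : κ → Program K M} {T : ι → K → List Bool} {r : K}
    {e : κ → ι → List Bool} {t : κ → ι → ℕ} (ht : ∀ k, PolyBounded size (t k))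
    (h : ∀ k i u, Runs (f k) (update (T i) r u) (update (T i) r (e k i ++ u)) (t k i))
    (ks : List κ) (u : ι → List Bool) :
    PolyRuns size (forAll f ks) (fun i => update (T i) r (u i))
      fun i => update (T i) r (ks.flatMap (e · i) ++ u i) := by
  induction ks with
  | nil => exact .of_runs (.const 1) fun i => runs_skip _
  | cons k ks ih =>
    refine ih.seq (.of_runs (ht k) fun i => (h k i _).congr ?_ le_rfl)
    rw [List.flatMap_cons, List.append_assoc]

/-- Prepend the word `l` to the register `k'`, as often as the register `k` is long. -/
def repeatWord (aux k k' : K) (l : List Bool) : Program K M :=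
  (drain k fun _ => (push aux true).seq (prependWord k' l)).seq (move aux k)

theorem runs_repeatWord {aux k k' : K} (hk : k ≠ aux) (hk' : k' ≠ aux) (hk'' : k ≠ k')
    {T : K → List Bool} (h : T aux = []) {n : ℕ} (hn : T k = List.replicate n true)
    (l : List Bool) :
    Runs (M := M) (repeatWord aux k k' l) T
      (update T k' ((List.replicate n l).flatten ++ T k')) (n * (l.length + 5) + 2) := by
  have h₁ : ∀ (n : ℕ) (T : K → List Bool), T k = List.replicate n true →
      Runs (M := M) (drain k fun _ => (push aux true).seq (prependWord k' l)) T
        (update (update (update T k []) aux (List.replicate n true ++ T aux)) k'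
          ((List.replicate n l).flatten ++ T k')) (n * (l.length + 3) + 1) := by
    intro n
    induction n with
    | zero =>
      intro T hn
      refine (runs_drain_nil hn).congr ?_ (by simp)
      funext j; simp only [update_apply]; split_ifs <;> simp_all
    | succ n ih =>
      intro T hn
      rw [List.replicate_succ] at hn
      refine (runs_drain_cons hn ((runs_push aux true _).seq (runs_prependWord k' l _))
        (ih _ (by simp [hk, hk'']))).congr ?_ (by ring_nf; omega)
      -- The induction puts the first copy of `l` behind the others, the statement in front; a word
      -- commutes with its powers.
      have e : (List.replicate n l).flatten ++ l = l ++ (List.replicate n l).flatten := by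
        rw [← List.flatten_cons, ← List.replicate_succ, List.replicate_succ']
        simp
      funext j
      simp only [update_apply]
      split_ifs <;> simp_all [List.replicate_succ']
      rw [← List.append_assoc, e, List.append_assoc]
  refine ((h₁ n T hn).seq (runs_move hk.symm _)).congr ?_ ?_
  · funext j; simp only [update_apply]; split_ifs <;> simp_all
  · rw [update_of_ne hk'.symm, update_self, h]
    simp
    ring_nf
    omega

end ForAll

/-! ### Validity tests and the input of the subroutine -/

section Checks

variable {κ : Type} {M : FinTM2} {α : Type} {n g : α → ℕ} {w : α → List Bool}

theorem SearchIndex.polyBounded_count (k : κ) :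
    PolyBounded (SearchIndex.size (n := n) g w) fun i => i.count k :=
  .of_le_size fun i => (i.count_le k).trans (by simp only [SearchIndex.size]; omega)

theorem SearchIndex.polyBounded_bound :
    PolyBounded (SearchIndex.size (κ := κ) (n := n) g w) fun i => n i.inst :=
  .of_le_size fun i => by simp only [SearchIndex.size]; omega

theorem SearchIndex.polyBounded_input :
    PolyBounded (SearchIndex.size (κ := κ) (n := n) g w) fun i => (w i.inst).length :=
  .of_le_size fun i => by simp only [SearchIndex.size]; omega

variable [DecidableEq κ]

/-- Test whether the sum of the counters in `ks` is the bound. -/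
def checkSum (ks : List κ) : Program (Reg κ) M :=
  (forAll (fun k => copyTo .aux (.val k) .left) ks).seq <|
    (copyTo .aux .first .right).seq (cancel .left .right .bad)

/-- The register `.bad` stays empty exactly when the counters add up to the bound. -/
theorem polyRuns_checkSum (ks : List κ) :
    PolyRuns (M := M) (SearchIndex.size g w) (checkSum ks) (SearchIndex.state (n := n) g w)
      fun i => update (i.state g w) .bad (List.replicate
        (((ks.map i.count).sum - n i.inst) + (n i.inst - (ks.map i.count).sum)) true) := by
  have hsum : PolyBounded (SearchIndex.size (n := n) g w) fun i => (ks.map i.count).sum :=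
    .listSum ks SearchIndex.polyBounded_count
  have h₁ := PolyRuns.forAll (M := M) (size := SearchIndex.size g w)
    (f := fun k => copyTo .aux (.val k) .left) (T := SearchIndex.state (n := n) g w)
    (r := .left) (e := fun k i => List.replicate (i.count k) true)
    (t := fun k i => 5 * i.count k + 2)
    (fun k => ((PolyBounded.const 5).mul (SearchIndex.polyBounded_count k)).add (.const 2))
    (fun k i u => (runs_copyTo (by simp) (by simp) (by simp)
      (by simp [SearchIndex.state, searchState])).congr
        (by simp [SearchIndex.state, searchState]) (by simp [SearchIndex.state, searchState]))
    ks fun _ => []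
  replace h₁ := h₁.congr (U := SearchIndex.state g w) (U' := fun i => update (i.state g w) .left
    (List.replicate (ks.map i.count).sum true)) (fun i => update_eq_self _ _) (fun i => by
      congr 1
      rw [List.append_nil]
      refine List.eq_replicate_iff.2 ⟨by simp [List.length_flatMap], ?_⟩
      simp +contextual)
  refine h₁.seq (.seq (T' := fun i => update (update (i.state g w) .left
    (List.replicate (ks.map i.count).sum true)) .right (List.replicate (n i.inst) true))
    (.of_runs (((PolyBounded.const 5).mul SearchIndex.polyBounded_bound).add (.const 2))
      fun i => ?_)
    (.of_runs ((((PolyBounded.const 3).mul hsum).add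
        ((PolyBounded.const 2).mul SearchIndex.polyBounded_bound)).add (.const 2)) fun i => ?_))
  · refine (runs_copyTo (by simp) (by simp) (by simp)
      (by simp [SearchIndex.state, searchState])).congr ?_ ?_ <;>
      simp [SearchIndex.state, searchState]
  · refine (runs_cancel (by simp) (by simp) (by simp) (by simp) (by simp)).congr ?_ le_rfl
    funext r
    simp only [update_apply]
    split_ifs <;> simp_all [SearchIndex.state, searchState]

/-- Test whether two registers differ. -/
def checkNe (r r' : Reg κ) : Program (Reg κ) M :=
  (copyTo .aux r .left).seq <| (copyTo .aux r' .right).seq <| (cancel .left .right .diff).seq <|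
    popCase .diff fun o => o.elim (push .bad true) fun _ => clear .diff

/-- Equality is the fault here: an empty difference adds a symbol to `.bad`, so the faults of
successive tests accumulate. -/
theorem runs_checkNe {r r' : Reg κ} (hr : r ∉ ({.aux, .left, .right, .diff} : Finset (Reg κ)))
    (hr' : r' ∉ ({.aux, .left, .right, .diff} : Finset (Reg κ))) {T : Reg κ → List Bool}
    (haux : T .aux = []) (hleft : T .left = []) (hright : T .right = []) (hdiff : T .diff = [])
    {x y : ℕ} (hx : T r = List.replicate x true) (hy : T r' = List.replicate y true) :
    Runs (M := M) (checkNe r r') T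
      (update T .bad ((if x = y then [true] else []) ++ T .bad)) (10 * x + 9 * y + 8) := by
  simp only [Finset.mem_insert, Finset.mem_singleton, not_or] at hr hr'
  have h₁ := runs_copyTo (M := M) (k' := .left) hr.1 (by simp) hr.2.1 haux
  rw [hx, hleft, List.append_nil] at h₁
  have h₂ := runs_copyTo (M := M) (k' := .right) hr'.1 (by simp) hr'.2.2.1
    (T := update T .left (List.replicate x true)) (by simpa using haux)
  rw [update_of_ne hr'.2.1, hy, update_of_ne (by simp), hright, List.append_nil] at h₂
  have h₃ := runs_cancel (M := M) (k := .left) (k' := .right) (d := .diff) (by simp) (by simp)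
    (by simp) (T := update (update T .left (List.replicate x true)) .right
      (List.replicate y true)) (m := x) (n := y) (by simp) (by simp)
  replace h₃ := h₃.congr (T' := update T .diff (List.replicate ((x - y) + (y - x)) true))
    (by funext j; simp only [update_apply]; split_ifs <;> simp_all) le_rfl
  have h₄ : Runs (M := M) (popCase .diff fun o => o.elim (push .bad true) fun _ => clear .diff)
      (update T .diff (List.replicate ((x - y) + (y - x)) true))
      (update T .bad ((if x = y then [true] else []) ++ T .bad)) (2 * (x + y) + 2) := by
    by_cases e : x = y
    · subst e
      refine (runs_popCase (n := 1) ?_).mono (by omega)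
      simp only [update_self, Nat.sub_self, Nat.add_zero, List.replicate_zero, List.head?_nil,
        List.tail_nil, Option.elim_none, if_true]
      refine (runs_push _ _ _).congr ?_ le_rfl
      funext j; simp only [update_apply]; split_ifs <;> simp_all
    · obtain ⟨d, hd⟩ : ∃ d, (x - y) + (y - x) = d + 1 :=
        Nat.exists_eq_succ_of_ne_zero (by omega)
      refine (runs_popCase (n := 2 * d + 1) ?_).mono (by omega)
      simp only [update_self, hd, List.replicate_succ, List.head?_cons, List.tail_cons,
        Option.elim_some, e, if_false]
      refine (runs_clear _ _).congr ?_ (by simp)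
      funext j; simp only [update_apply]; split_ifs <;> simp_all
  refine (h₁.seq (h₂.seq (h₃.seq h₄))).congr rfl ?_
  simp
  omega

/-- The counter `k`, or the bound of all counters. -/
def counterReg : Option κ → Reg κ
  | none => .first
  | some k => .val k

/-- Counters never exceed the bound, so differing from it means being strictly below it. Tests of
inequality thus cover both the range of the entries of a vote and their distinctness. -/
theorem polyRuns_checkNe (ps : List (Option κ × Option κ)) :
    PolyRuns (M := M) (SearchIndex.size g w)
      (forAll (fun p => checkNe (counterReg p.1) (counterReg p.2)) ps)
      (SearchIndex.state (n := n) g w)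
      fun i => update (i.state g w) .bad (ps.flatMap fun p =>
        if p.1.elim (n i.inst) i.count = p.2.elim (n i.inst) i.count then [true] else []) := by
  have hb : ∀ o : Option κ, PolyBounded (SearchIndex.size (n := n) g w)
      fun i => o.elim (n i.inst) i.count
    | none => SearchIndex.polyBounded_bound
    | some k => SearchIndex.polyBounded_count k
  have hs : ∀ (o : Option κ) (i : SearchIndex κ n) (u : List Bool),
      update (i.state g w) .bad u (counterReg o) =
        List.replicate (o.elim (n i.inst) i.count) true := by
    rintro (_ | k) i u <;> simp [counterReg, SearchIndex.state, searchState]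
  have hr : ∀ o : Option κ, counterReg o ∉ ({.aux, .left, .right, .diff} : Finset (Reg κ)) := by
    rintro (_ | k) <;> simp [counterReg]
  have h := PolyRuns.forAll (M := M) (size := SearchIndex.size g w)
    (f := fun p => checkNe (counterReg p.1) (counterReg p.2))
    (T := SearchIndex.state (n := n) g w) (r := .bad)
    (e := fun p i => if p.1.elim (n i.inst) i.count = p.2.elim (n i.inst) i.count
      then [true] else [])
    (fun p => (((PolyBounded.const 10).mul (hb p.1)).add ((PolyBounded.const 9).mul
      (hb p.2))).add (.const 8))
    (fun p i u => (runs_checkNe (hr _) (hr _) (by simp [SearchIndex.state, searchState])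
      (by simp [SearchIndex.state, searchState]) (by simp [SearchIndex.state, searchState])
      (by simp [SearchIndex.state, searchState]) (hs _ _ _) (hs _ _ _)).congr
        (by simp) le_rfl) ps fun _ => []
  exact h.congr (fun i => update_eq_self _ _) fun i => by rw [List.append_nil]

/-- Write the input word, then prepend words for all counters in `ks`, then a header. -/
def buildWord (emit : κ → Program (Reg κ) M) (ks : List κ) (header : Program (Reg κ) M) :
    Program (Reg κ) M :=
  (copyTo .aux .input .word).seq <| (forAll emit ks).seq header

/-- Registers grow at the front, so the word is written from its end. This is why absent votes
precede the known ones in the elections passed to the subroutine. -/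
theorem polyRuns_buildWord {emit : κ → Program (Reg κ) M} {header : Program (Reg κ) M}
    {e : κ → SearchIndex κ n → List Bool} {t : κ → SearchIndex κ n → ℕ}
    {e' : SearchIndex κ n → List Bool} {t' : SearchIndex κ n → ℕ}
    (ht : ∀ k, PolyBounded (SearchIndex.size g w) (t k))
    (ht' : PolyBounded (SearchIndex.size g w) t')
    (h : ∀ k i u, Runs (emit k) (update (i.state g w) .word u)
      (update (i.state g w) .word (e k i ++ u)) (t k i))
    (h' : ∀ i u, Runs header (update (i.state g w) .word u)
      (update (i.state g w) .word (e' i ++ u)) (t' i)) (ks : List κ) :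
    PolyRuns (SearchIndex.size g w) (buildWord emit ks header) (SearchIndex.state (n := n) g w)
      fun i => update (i.state g w) .word (e' i ++ (ks.flatMap (e · i) ++ w i.inst)) := by
  refine .seq (T' := fun i => update (i.state g w) .word (w i.inst)) (.of_runs
    (((PolyBounded.const 5).mul SearchIndex.polyBounded_input).add (.const 2))
      fun i => (runs_copyTo (by simp) (by simp) (by simp)
        (by simp [SearchIndex.state, searchState])).congr ?_ ?_)
    ((PolyRuns.forAll ht h ks _).seq (.of_runs ht' fun i => h' i _)) <;>
  simp [SearchIndex.state, searchState]

end Checks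

end StackProgram

/-! ### Fixed number of candidates: absent votes as multiplicities -/

section AbsentVotes

open Turing StackProgram

variable {ℓ : ℕ}

/-- The profile in which each vote `v` occurs `c v` times. -/
noncomputable def profileOfCounts {m : ℕ} (c : TopRanking ℓ m → ℕ) : Profile ℓ m :=
  Finset.univ.toList.flatMap fun v => List.replicate (c v) v

theorem length_profileOfCounts {m : ℕ} (c : TopRanking ℓ m → ℕ) :
    (profileOfCounts c).length = (Finset.univ.toList.map c).sum := by
  simp [profileOfCounts, List.length_flatMap]

/-- A profile is determined up to order by its multiplicities, so these are all that an anonymous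
rule can see. -/
theorem perm_profileOfCounts {m : ℕ} (P : Profile ℓ m) :
    (profileOfCounts fun v => P.count v).Perm P := by
  refine List.perm_iff_count.2 fun v => ?_
  have h : ∀ l : List (TopRanking ℓ m), l.Nodup → v ∈ l →
      List.count v (l.flatMap fun v => List.replicate (P.count v) v) = P.count v := by
    intro l hl hv
    induction l with
    | nil => cases hv
    | cons u l ih =>
      obtain ⟨hu, hl⟩ := List.nodup_cons.1 hl
      rw [List.flatMap_cons, List.count_append, List.count_replicate]
      by_cases e : v = u
      · subst e
        have : List.count v (l.flatMap fun v => List.replicate (P.count v) v) = 0 := by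
          refine List.count_eq_zero.2 fun h => ?_
          obtain ⟨u, hu', h⟩ := List.mem_flatMap.1 h
          rw [List.eq_of_mem_replicate h] at hu
          exact hu hu'
        simp [this]
      · have e' : ¬ (u == v) = true := by simpa using Ne.symm e
        rw [if_neg e', Nat.zero_add]
        exact ih hl ((List.mem_cons.1 hv).resolve_left e)
  exact h _ (Finset.nodup_toList _) (by simp)

theorem encodeProfile_append {m : ℕ} (P Q : Profile ℓ m) :
    encodeProfile (P ++ Q) = encodeProfile P ++ encodeProfile Q :=
  List.flatMap_append

theorem encodeProfile_profileOfCounts {m : ℕ} (c : TopRanking ℓ m → ℕ) :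
    encodeProfile (profileOfCounts c) =
      Finset.univ.toList.flatMap fun v => (List.replicate (c v) (encodeVote v)).flatten := by
  rw [encodeProfile, profileOfCounts, List.flatMap_assoc]
  congr 1
  funext v
  rw [List.flatMap_def, List.map_replicate]

/-- Anonymity allows the absent votes to be sorted and put in front of the known ones. The bound on
each `c v` already follows from the sum; it is stated because it makes the search finite. -/
theorem wav_iff_exists_counts {r : VotingRule ℓ} (hr : r.Anonymous) (m : ℕ+) (P : Profile ℓ m)
    (t : ℕ) (x : Fin m) :
    r.WAV m P t x ↔ ∃ c : TopRanking ℓ m → ℕ, (∀ v, c v ≤ t) ∧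
      (Finset.univ.toList.map c).sum = t ∧ (r m (profileOfCounts c ++ P) : ℕ) = x := by
  constructor
  · rintro ⟨P', rfl, rfl⟩
    refine ⟨fun v => P'.count v, fun v => List.count_le_length, ?_, ?_⟩
    · rw [← length_profileOfCounts]
      exact (perm_profileOfCounts P').length_eq
    · exact congrArg _ (hr m _ _
        (((perm_profileOfCounts P').append_right P).trans List.perm_append_comm))
  · rintro ⟨c, -, h, h'⟩
    refine ⟨profileOfCounts c, by rw [length_profileOfCounts, h], ?_⟩
    rw [hr m _ _ List.perm_append_comm]
    exact Fin.ext h'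

theorem polyTimeSolvable_fixedCandidates {r : VotingRule ℓ} (hr : r.Anonymous)
    (hpoly : r.PolyTimeComputable) (m : ℕ+) :
    PolyTimeSolvable (FixedCandidatesInstance.encode (ℓ := ℓ) (m := m))
      fun I => r.WAV m I.known I.absent I.target := by
  classical
  obtain ⟨h⟩ := hpoly
  let n (I : FixedCandidatesInstance ℓ m) : ℕ := I.absent
  let g (I : FixedCandidatesInstance ℓ m) : ℕ := I.target
  let w (I : FixedCandidatesInstance ℓ m) : List Bool := encodeProfile I.known
  let ks : List (TopRanking ℓ m) := Finset.univ.toList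
  let word (I : FixedCandidatesInstance ℓ m) (c : TopRanking ℓ m → ℕ) : List Bool :=
    encodeElection ⟨m, profileOfCounts c ++ I.known⟩
  have hword : ∀ I c, word I c = encodeField m ++
      (ks.flatMap (fun v => (List.replicate (c v) (encodeVote v)).flatten) ++ w I) := by
    intro I c
    simp only [word, encodeElection, encodeProfile_append, encodeProfile_profileOfCounts]
    rfl
  have hbuild := polyRuns_buildWord (M := h.tm) (n := n) (g := g) (w := w)
    (emit := fun v => repeatWord .aux (.val v) .word (encodeVote v))
    -- As `m` is a constant, its field is a fixed word of the program.
    (header := prependWord .word (encodeField m))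
    (e := fun v i => (List.replicate (i.count v) (encodeVote v)).flatten)
    (e' := fun _ => encodeField m)
    (fun v => ((SearchIndex.polyBounded_count v).mul
      (.const ((encodeVote v).length + 5))).add (.const 2)) (.const _)
    (fun v i u => (runs_repeatWord (by simp) (by simp) (by simp)
      (by simp [SearchIndex.state, searchState]) (n := i.count v)
      (by simp [SearchIndex.state, searchState]) _).congr (by simp) le_rfl)
    (fun i u => (runs_prependWord _ _ _).congr (by simp) le_rfl) ks
  have hA := polyRuns_attempt (e₀ := h.inputAlphabet) (e₁ := h.outputAlphabet)
    (valid := fun I c => (ks.map c).sum = I.absent) (word := word)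
    (out := fun I c => (r m (profileOfCounts c ++ I.known) : ℕ))
    (((PolyBounded.listSum ks SearchIndex.polyBounded_count).add
      SearchIndex.polyBounded_bound).mono fun i => by
        rw [List.length_replicate]
        change _ ≤ (ks.map i.count).sum + _
        omega)
    (fun i => by
      rw [List.replicate_eq_nil_iff]
      change _ ↔ _ = n i.inst
      omega)
    (polyRuns_checkSum ks) (hbuild.congr (fun _ => rfl) fun i => by rw [hword])
    (((PolyBounded.const (encodeField m).length).add ((PolyBounded.listSum ks fun v =>
      (SearchIndex.polyBounded_count v).mul (.const (encodeVote v).length)).add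
        SearchIndex.polyBounded_input)).mono fun i => by
          rw [hword]
          simp [List.length_flatMap])
    -- The winner's index is at most `m`, which bounds the length of the unary output.
    ((PolyBounded.const m).mono fun i => Fin.is_le') h.time
    (fun i _ => ⟨h.outputsFun ⟨m, profileOfCounts i.count ++ i.inst.known⟩⟩)
  have := polyTimeSolvable_search (n := n) (g := g) (w := w)
    (R := fun I c => (ks.map c).sum = I.absent ∧ (r m (profileOfCounts c ++ I.known) : ℕ) = g I)
    (enc := FixedCandidatesInstance.encode)
    (fun I => by simp only [FixedCandidatesInstance.encode, List.append_assoc, n, g, w])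
    (hA.congr (fun _ => rfl) fun i => by congr!)
  convert this using 2 with I
  exact wav_iff_exists_counts hr m _ _ _

/-! ### Fixed number of absent votes: one counter per position of each vote -/

/-- The counters `c (i, ·)` are the votes of a profile of length `t`. -/
def IsProfile (m t : ℕ) (c : Fin t × Fin ℓ → ℕ) : Prop :=
  (∀ k, c k < m) ∧ ∀ i, Function.Injective fun j => c (i, j)

def IsProfile.profile {m t : ℕ} {c : Fin t × Fin ℓ → ℕ} (h : IsProfile m t c) : Profile ℓ m :=
  List.ofFn fun i => ⟨fun j => ⟨c (i, j), h.1 (i, j)⟩, fun _ _ e => h.2 i (Fin.mk.inj e)⟩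

/-- The positions of all votes of a profile of length `t`. -/
def positions (ℓ t : ℕ) : List (Fin t × Fin ℓ) :=
  (List.finRange t).flatMap fun i => (List.finRange ℓ).map fun j => (i, j)

theorem IsProfile.encodeProfile_profile {m t : ℕ} {c : Fin t × Fin ℓ → ℕ}
    (h : IsProfile m t c) :
    encodeProfile h.profile = (positions ℓ t).flatMap fun k => encodeField (c k) := by
  rw [encodeProfile, profile, List.ofFn_eq_map, List.flatMap_map, positions, List.flatMap_assoc]
  congr 1
  funext i
  rw [encodeVote, List.ofFn_eq_map, List.flatMap_map, List.flatMap_map]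
  rfl

/-- The entries of a profile serve as the counters; anonymity is needed only to move the absent
votes in front. -/
theorem wav_iff_exists_isProfile {r : VotingRule ℓ} (hr : r.Anonymous) (m : ℕ+) (P : Profile ℓ m)
    (t : ℕ) (x : Fin m) :
    r.WAV m P t x ↔ ∃ (c : Fin t × Fin ℓ → ℕ) (h : IsProfile m t c),
      r m (h.profile ++ P) = x := by
  constructor
  · rintro ⟨P', rfl, rfl⟩
    have h : IsProfile m P'.length (fun k : Fin P'.length × Fin ℓ => (P'.get k.1 k.2 : ℕ)) :=
      ⟨fun k => (P'.get k.1 k.2).2, fun i j j' e => (P'.get i).injective (Fin.ext e)⟩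
    have e : h.profile = P' := by
      conv_rhs => rw [← List.ofFn_get P']
      rfl
    refine ⟨_, h, ?_⟩
    rw [e]
    exact hr m _ _ List.perm_append_comm
  · rintro ⟨c, h, h'⟩
    refine ⟨h.profile, by simp [IsProfile.profile], ?_⟩
    rw [← h']
    exact hr m _ _ List.perm_append_comm

theorem polyTimeSolvable_fixedAbsent {r : VotingRule ℓ} (hr : r.Anonymous)
    (hpoly : r.PolyTimeComputable) (t : ℕ) :
    PolyTimeSolvable (FixedAbsentInstance.encode (ℓ := ℓ))
      fun I => r.WAV I.candidates I.known t I.target := by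
  classical
  obtain ⟨h⟩ := hpoly
  -- With this bound the counters also take the value `m`, which is no candidate; the test against
  -- the bound rejects it.
  let n (I : FixedAbsentInstance ℓ) : ℕ := I.candidates
  let g (I : FixedAbsentInstance ℓ) : ℕ := I.target
  let w (I : FixedAbsentInstance ℓ) : List Bool := encodeProfile I.known
  let κ := Fin t × Fin ℓ
  -- The pairs that must differ: any entry and the bound (second component `none`, where the
  -- condition is vacuous), and two distinct positions of the same vote.
  let ps : List (Option κ × Option κ) := (Finset.univ.filter fun p : Option κ × Option κ =>
    p.1.isSome ∧ ∀ k ∈ p.1, ∀ k' ∈ p.2, k.1 = k'.1 ∧ k ≠ k').toList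
  let word (I : FixedAbsentInstance ℓ) (c : κ → ℕ) : List Bool := encodeField (n I) ++
    ((positions ℓ t).flatMap (fun k => encodeField (c k)) ++ w I)
  -- The default 0 has no effect, since success of a round also requires validity.
  let out (I : FixedAbsentInstance ℓ) (c : κ → ℕ) : ℕ :=
    if h : IsProfile I.candidates t c then (r I.candidates (h.profile ++ I.known) : ℕ) else 0
  have hbuild := polyRuns_buildWord (M := h.tm) (n := n) (g := g) (w := w) (κ := κ)
    -- The end marker is pushed first because registers grow at the front. The header copies `m`
    -- from `.first`, as it now belongs to the input.
    (emit := fun k => (push .word false).seq (copyTo .aux (.val k) .word))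
    (header := (push .word false).seq (copyTo .aux .first .word))
    (e := fun k i => encodeField (i.count k)) (e' := fun i => encodeField (n i.inst))
    (fun k => (PolyBounded.const 1).add
      (((PolyBounded.const 5).mul (SearchIndex.polyBounded_count k)).add (.const 2)))
    ((PolyBounded.const 1).add
      (((PolyBounded.const 5).mul SearchIndex.polyBounded_bound).add (.const 2)))
    (fun k i u => ((runs_push _ _ _).seq (runs_copyTo (by simp) (by simp) (by simp)
      (by simp [SearchIndex.state, searchState]))).congr
        (by simp [SearchIndex.state, searchState, encodeField_eq])
        (by simp [SearchIndex.state, searchState]))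
    (fun i u => ((runs_push _ _ _).seq (runs_copyTo (by simp) (by simp) (by simp)
      (by simp [SearchIndex.state, searchState]))).congr
        (by simp [SearchIndex.state, searchState, encodeField_eq])
        (by simp [SearchIndex.state, searchState])) (positions ℓ t)
  have hA := polyRuns_attempt (e₀ := h.inputAlphabet) (e₁ := h.outputAlphabet)
    (valid := fun I c => IsProfile I.candidates t c) (word := word) (out := out)
    (x := fun i => ps.flatMap fun p =>
        if p.1.elim (n i.inst) i.count = p.2.elim (n i.inst) i.count then [true] else [])
    ((PolyBounded.const ps.length).mono fun i => by
      rw [List.length_flatMap]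
      refine (List.sum_le_card_nsmul _ 1 fun x hx => ?_).trans (by simp)
      obtain ⟨p, -, rfl⟩ := List.mem_map.1 hx
      split <;> simp)
    (fun i => by
      rw [List.flatMap_eq_nil_iff]
      constructor
      · intro hps
        refine ⟨fun k => lt_of_le_of_ne (i.count_le k) fun e => ?_, fun a j j' e => ?_⟩
        · have := hps (some k, none) (by simp [ps])
          rw [if_pos (by simpa using e)] at this
          cases this
        · by_contra hj
          have := hps (some (a, j), some (a, j')) (by
            simp only [ps, Finset.mem_toList, Finset.mem_filter, Option.mem_def,
              Option.some.injEq, forall_eq']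
            exact ⟨Finset.mem_univ _, rfl, trivial, fun e => hj (Prod.mk.inj e).2⟩)
          rw [if_pos (by simpa using e)] at this
          cases this
      · rintro hc ⟨_ | ⟨a, j⟩, _ | ⟨a', j'⟩⟩ hp
        · simp [ps] at hp
        · simp [ps] at hp
        · exact if_neg (hc.1 (a, j)).ne
        · simp only [ps, Finset.mem_toList, Finset.mem_filter, Option.mem_def,
            Option.some.injEq, forall_eq'] at hp
          obtain ⟨-, -, rfl, hp⟩ := hp
          exact if_neg fun e => hp (by rw [hc.2 a e]))
    (polyRuns_checkNe ps) hbuild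
    (((SearchIndex.polyBounded_bound.add (.const 1)).add ((PolyBounded.listSum (positions ℓ t)
      fun k => (SearchIndex.polyBounded_count k).add (.const 1)).add
        SearchIndex.polyBounded_input)).mono fun i => by
          simp [word, List.length_flatMap, encodeField_eq]
          omega)
    (SearchIndex.polyBounded_bound.mono fun i => by
      simp only [out]
      split
      · exact Fin.is_le'
      · exact Nat.zero_le _) h.time
    (fun i hi => by
      have := h.outputsFun ⟨i.inst.candidates, hi.profile ++ i.inst.known⟩
      have e : encodeElection ⟨i.inst.candidates, hi.profile ++ i.inst.known⟩ =
          word i.inst i.count := by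
        simp only [encodeElection, encodeProfile_append, hi.encodeProfile_profile]
        rfl
      have e' : out i.inst i.count = (r i.inst.candidates (hi.profile ++ i.inst.known) : ℕ) :=
        dif_pos hi
      rw [e']
      rw [e] at this
      exact ⟨this⟩)
  have := polyTimeSolvable_search (n := n) (g := g) (w := w)
    (R := fun I c => IsProfile I.candidates t c ∧ out I c = g I)
    (enc := FixedAbsentInstance.encode)
    (fun I => by simp only [FixedAbsentInstance.encode, List.append_assoc, n, g, w])
    (hA.congr (fun _ => rfl) fun i => by congr!)
  convert this using 2 with I
  rw [wav_iff_exists_isProfile hr]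
  constructor
  · rintro ⟨c, hc, h'⟩
    refine ⟨c, fun k => (hc.1 k).le, hc, ?_⟩
    simp only [out, dif_pos hc, h', g]
  · rintro ⟨c, -, hc, h'⟩
    refine ⟨c, hc, Fin.ext ?_⟩
    simpa only [out, dif_pos hc] using h'

end AbsentVotes

theorem proposition1 (ℓ : ℕ) (hℓ : 2 ≤ ℓ) (r : VotingRule ℓ) (hr : r.Anonymous)
    (hpoly : r.PolyTimeComputable) :
    (∀ m : ℕ+, 2 ≤ m →
      PolyTimeSolvable (FixedCandidatesInstance.encode (ℓ := ℓ) (m := m))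
        fun I => r.WAV m I.known I.absent I.target) ∧
    (∀ t : ℕ,
      PolyTimeSolvable (FixedAbsentInstance.encode (ℓ := ℓ))
        fun I => r.WAV I.candidates I.known t I.target) :=
  ⟨fun m _ => polyTimeSolvable_fixedCandidates hr hpoly m,
    fun t => polyTimeSolvable_fixedAbsent hr hpoly t⟩
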